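/- Let $G$ be a finite connected graph with $e(G)$ edges. Each vertex has one of the two strategies $1,2$; the initial strategies are independent and uniformly distributed. At each time step $1,2,3,\dots$ an edge of $G$ is chosen uniformly at random (independently of everything before), and both of its endpoints adopt the higher of their two strategies with probability $p$ and the lower one with probability $1-p$. The expected time of the process on $G$ is $\mathbb E[T]$, where $T\ge 0$ is the first time at which all vertices have the same strategy (so $T=0$ if they agree at the start). For integers $0\le r<n$, let the sundew $\mathrm{Sd}_{n,r}$ be the graph on $n$ vertices that consists of a clique of size $n-r$ and $r$ pendant edges attached to the clique vertices as evenly as possible, and let the lollipop $\mathrm{Lp}_{n,r}$ be the graph on $n$ vertices that consists of a clique of size $n-r$ and a pendant path of length $r$ (that is, with $r$ edges and $r$ new vertices) attached to one clique vertex. Write $h(r)=\sum_{i=1}^r 1/i$, and let $\log$ be the natural logarithm. **Theorem.** Let $p=0$. The expected times of $\mathrm{Sd}_{n,r}$ and $\mathrm{Lp}_{n,r}$ are finite, and, as both $r$ and $n-r$ tend to infinity, $\mathrm{Sd}_{n,r}$ has expected time $$e(\mathrm{Sd}_{n,r})\,(h(r)-\log 2+o(1)),$$ whereas $\mathrm{Lp}_{n,r}$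 has expected time $$e(\mathrm{Lp}_{n,r})\,(h(r)-\log 4+o(1)).$$ In particular, since $e(\mathrm{Sd}_{n,r})=e(\mathrm{Lp}_{n,r})$, the sundew has the higher expected time if $n-r$ and $r$ are both large: there is an $N$ such that, whenever $r\ge N$ and $n-r\ge N$, the expected time of $\mathrm{Sd}_{n,r}$ is strictly larger than that of $\mathrm{Lp}_{n,r}$. -/

import Mathlib

open MeasureTheory Filter Topology
open scoped ENNReal

noncomputable section

namespace Consensus

/-! ### The consensus process on a finite graph -/

/-- One interaction: the edge that is sampled, and whether the higher (`true`) or the lower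
(`false`) of the two strategies is adopted by both endpoints. -/
structure Interaction {V : Type*} (G : SimpleGraph V) where
  edge : G.edgeSet
  higher : Bool

instance {V : Type*} (G : SimpleGraph V) : MeasurableSpace (Interaction G) := ⊤

variable {V : Type*}

open scoped Classical in
/-- The configuration after an interaction: both endpoints of the sampled edge get the higher,
respectively lower, of their two strategies, and all other vertices keep theirs. -/
def Interaction.apply {G : SimpleGraph V} {m : ℕ} (a : Interaction G) (x : V → Fin m) :
    V → Fin m := fun v =>
  if v ∈ (a.edge : Sym2 V) then
    (if a.higher then ((a.edge : Sym2 V).map x).sup else ((a.edge : Sym2 V).map x).inf)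
  else x v

open scoped Classical in
/-- The law of one interaction: a uniformly random edge, and independently the higher strategy with
probability `p` and the lower one with probability `1 - p`. -/
def interactionPMF [Fintype V] (G : SimpleGraph V) [Nonempty G.edgeSet] (p : unitInterval) :
    PMF (Interaction G) :=
  (PMF.uniformOfFintype G.edgeSet).bind fun e =>
    (ProbabilityTheory.bernoulliMeasure true false p).toPMF.map fun b => ⟨e, b⟩

/-- The configuration at time `t`, from the initial configuration `x` and the sequence `a` of
interactions. -/
def config {G : SimpleGraph V} {m : ℕ} (x : V → Fin m) (a : ℕ → Interaction G) :
    ℕ → V → Fin m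
  | 0 => x
  | t + 1 => (a t).apply (config x a t)

/-- All vertices have the same strategy. -/
def IsConsensus {m : ℕ} (x : V → Fin m) : Prop := ∀ u v, x u = x v

/-- The first time at which consensus holds (`∞` if there is none). -/
def consensusTime {G : SimpleGraph V} {m : ℕ} (x : V → Fin m) (a : ℕ → Interaction G) : ℝ≥0∞ :=
  ⨅ (t : ℕ) (_ : IsConsensus (config x a t)), (t : ℝ≥0∞)

open scoped Classical in
/-- The law of the initial configuration together with the sequence of interactions: the initial
configuration is uniform on `V → Fin m` (so the strategies of the vertices are independent and
uniform), the interactions are independent and identically distributed, and independent of it. -/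
def processLaw [Fintype V] (G : SimpleGraph V) [Nonempty G.edgeSet] (m : ℕ) [NeZero m]
    (p : unitInterval) : Measure ((V → Fin m) × (ℕ → Interaction G)) :=
  (PMF.uniformOfFintype (V → Fin m)).toMeasure.prod
    (Measure.infinitePi fun _ : ℕ => (interactionPMF G p).toMeasure)

open scoped Classical in
/-- The expected time until consensus on `G`, with `m` strategies and parameter `p`. A connected
graph without edges has at most one vertex, and then consensus holds from the start. -/
def expectedTime [Fintype V] (G : SimpleGraph V) (m : ℕ) [NeZero m] (p : unitInterval) :
    ℝ≥0∞ :=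
  if h : Nonempty G.edgeSet then
    haveI := h
    ∫⁻ ω, consensusTime ω.1 ω.2 ∂(processLaw G m p)
  else 0

/-- The expected time until consensus for `p = 0` and two strategies. -/
def expectedTimeZero [Fintype V] (G : SimpleGraph V) : ℝ≥0∞ :=
  expectedTime G 2 0

/-- The number of edges `e(G)`. -/
def numEdges (G : SimpleGraph V) : ℕ := Nat.card G.edgeSet

/-! ### The two families of graphs, on `n` vertices when `r ≤ n` -/

/-- The sundew: a clique on the `n - r` vertices `inl a`, and `r` pendant vertices `inr j`, which
are attached to the clique cyclically (`inr j` to the clique vertex `j mod (n - r)`), hence as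
evenly as possible. -/
def sundew (n r : ℕ) : SimpleGraph (Fin (n - r) ⊕ Fin r) :=
  SimpleGraph.fromRel fun u v =>
    match u, v with
    | .inl _, .inl _ => True
    | .inl a, .inr j => (a : ℕ) = (j : ℕ) % (n - r)
    | _, _ => False

/-- The lollipop: a clique on the `n - r` vertices `inl a`, and a pendant path of length `r`, which
runs from the clique vertex `inl 0` through `inr 0`, `inr 1`, …, `inr (r - 1)`. -/
def lollipop (n r : ℕ) : SimpleGraph (Fin (n - r) ⊕ Fin r) :=
  SimpleGraph.fromRel fun u v =>
    match u, v with
    | .inl _, .inl _ => True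
    | .inl a, .inr j => (a : ℕ) = 0 ∧ (j : ℕ) = 0
    | .inr i, .inr j => (j : ℕ) = (i : ℕ) + 1
    | _, _ => False

/-- The limit regime for a pair `(n, r)`: both `r` and `n - r` tend to infinity. -/
def bothLarge : Filter (ℕ × ℕ) :=
  comap (fun q : ℕ × ℕ => q.2) atTop ⊓ comap (fun q : ℕ × ℕ => q.1 - q.2) atTop

end Consensus

end

open MeasureTheory Filter Topology
open scoped ENNReal

noncomputable section

namespace Consensus

/-! ### Reduction to a linear recursion -/

/-! At `p = 0` the low strategy only spreads. The mean time obeys a discrete Poisson equation: a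
nonnegative `φ` with `∑ e, (φ x - φ (stepLow e x)) ≥ 1` off consensus bounds the mean time from `x`
above by `e(G) * φ x`, and the reversed inequality, with `φ = 0` at consensus, bounds it below. So
potentials have to be found and averaged over the initial configuration (`expectedTimeZero_le`,
`le_expectedTimeZero`).

In both graphs the clique, of size `m`, contributes `o(1)` to the potential. With `c` low clique
vertices, `c * (m - c)` edges produce another one, for a total of at most `2 h(m-1) / m`; a clique
without low vertices has probability `2 ^ (-m)` (`expectedTimeZero_le_clique`,
`average_cliquePart_le`). What matters is how the low strategy fills the pendant part from an
all-low clique.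

For the sundew this is coupon collecting: `k` high pendant vertices cost `h(k)`. Here `k` is
binomial with parameters `r` and `1/2`, and the average of `h(k)` is `h(r) - ∑ i ≤ r, 2 ^ (-i) / i`,
hence `h(r) - log 2 + o(1)`.

For the lollipop, let the edges ring at rate one in continuous time. The gaps, that is, the maximal
runs of high path vertices, then close independently: inner gaps from both ends, at total rate two,
and the final gap from one end. The probability that all are closed by time `t` is a product of
Erlang distribution functions (`gapProd`). It satisfies the backward equation, so the mean closing
time `gapTime` solves the Poisson equation (`sum_gapTime_sub`). On a random path the gap lengths are
geometric, and a geometric number of exponentials of rate two is zero with probability `1/2` and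
otherwise exponential of rate one. A gap thus behaves like one pendant vertex of a sundew. There are
about `r/2` gaps, by a second-moment bound (`avgGap_le`, `le_avgGap`), which gives `h(r/2) - log 2`,
that is, `h(r) - log 4 + o(1)`. The final gap is negligible (`tendsto_integral_endGap`). -/

/-- The sequence with first term `b`, followed by `a`. -/
def consSeq {α : Type*} (b : α) (a : ℕ → α) : ℕ → α
  | 0 => b
  | i + 1 => a i

theorem measurable_consSeq {α : Type*} [MeasurableSpace α] :
    Measurable (fun q : α × (ℕ → α) => consSeq q.1 q.2) := by
  refine measurable_pi_lambda _ fun i => ?_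
  cases i with
  | zero => exact measurable_fst
  | succ i => exact (measurable_pi_apply i).comp measurable_snd

/-- An i.i.d. sequence is one term followed by an independent copy of the sequence. This is the
Markov property at time one, which drives the recursion in `lintegral_config`. -/
theorem map_consSeq {α : Type*} [MeasurableSpace α] (μ : Measure α)
    [IsProbabilityMeasure μ] :
    Measure.map (fun q : α × (ℕ → α) => consSeq q.1 q.2)
      (μ.prod (Measure.infinitePi fun _ : ℕ => μ)) = Measure.infinitePi fun _ : ℕ => μ := by
  refine Measure.eq_infinitePi _ fun s t ht => ?_
  classical
  rw [Measure.map_apply measurable_consSeq (MeasurableSet.pi s.countable_toSet fun i _ => ht i)]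
  have hpre : (fun q : α × (ℕ → α) => consSeq q.1 q.2) ⁻¹'
      (Set.pi s t) = (if 0 ∈ s then t 0 else Set.univ) ×ˢ
        Set.pi (s.preimage Nat.succ Nat.succ_injective.injOn : Finset ℕ)
          (fun i => t (i + 1)) := by
    ext ⟨b, a⟩
    simp only [Set.mem_preimage, Set.mem_pi, Set.mem_prod, Finset.mem_coe, Finset.mem_preimage]
    constructor
    · intro h
      refine ⟨?_, fun i hi => h (i + 1) hi⟩
      split_ifs with h0
      · exact h 0 h0
      · trivial
    · rintro ⟨h0, h1⟩ i hi
      cases i with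
      | zero => rwa [if_pos hi] at h0
      | succ i => exact h1 i hi
  rw [hpre, Measure.prod_prod, Measure.infinitePi_pi _ fun i _ => ht (i + 1)]
  have hprod : ∏ i ∈ s.preimage Nat.succ Nat.succ_injective.injOn, μ (t (i + 1)) =
      ∏ i ∈ s.erase 0, μ (t i) := by
    rw [Finset.prod_preimage' Nat.succ s Nat.succ_injective.injOn (fun i => μ (t i))]
    refine Finset.prod_congr ?_ fun _ _ => rfl
    ext i
    cases i <;> simp
  rw [hprod]
  by_cases h0 : 0 ∈ s
  · rw [if_pos h0, Finset.mul_prod_erase s (fun i => μ (t i)) h0]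
  · rw [if_neg h0, measure_univ, one_mul, Finset.erase_eq_of_notMem h0]

variable {V : Type*}

/-- The configuration after the low strategy has been adopted along `e`. -/
def stepLow {G : SimpleGraph V} (e : G.edgeSet) (x : V → Fin 2) : V → Fin 2 :=
  (Interaction.mk e false).apply x

theorem lintegral_interactionPMF_zero [Fintype V] (G : SimpleGraph V) [Nonempty G.edgeSet]
    [Fintype G.edgeSet] (g : Interaction G → ℝ≥0∞) :
    ∫⁻ b, g b ∂(interactionPMF G 0).toMeasure =
      (Fintype.card G.edgeSet : ℝ≥0∞)⁻¹ * ∑ e : G.edgeSet, g ⟨e, false⟩ := by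
  have h1 : interactionPMF G 0 =
      (PMF.uniformOfFintype G.edgeSet).map (fun e => (⟨e, false⟩ : Interaction G)) := by
    unfold interactionPMF
    have h2 : (ProbabilityTheory.bernoulliMeasure true false 0).toPMF = PMF.pure false := by
      rw [← PMF.toMeasure_inj, Measure.toPMF_toMeasure,
        ProbabilityTheory.bernoulliMeasure_zero, PMF.toMeasure_pure]
    rw [h2]
    simp only [PMF.pure_map]
    rw [← PMF.bind_pure_comp]
    congr!
  let _ : MeasurableSpace G.edgeSet := ⊤
  rw [h1, ← PMF.toMeasure_map _ _ measurable_from_top, lintegral_map measurable_from_top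
    measurable_from_top, lintegral_fintype, Finset.mul_sum]
  refine Finset.sum_congr rfl fun e _ => ?_
  rw [PMF.toMeasure_apply_singleton _ _ (measurableSet_singleton e), PMF.uniformOfFintype_apply,
    mul_comm]

theorem stepLow_mk {G : SimpleGraph V} {a b : V} (h : s(a, b) ∈ G.edgeSet) (x : V → Fin 2) (v : V)
    [Decidable (v = a ∨ v = b)] :
    stepLow ⟨s(a, b), h⟩ x v = if v = a ∨ v = b then x a ⊓ x b else x v := by
  simp [stepLow, Interaction.apply]

theorem IsConsensus.apply {G : SimpleGraph V} {m : ℕ} {x : V → Fin m} (hx : IsConsensus x)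
    (b : Interaction G) : IsConsensus (b.apply x) := by
  have : b.apply x = x := by
    funext v
    obtain ⟨⟨e, he⟩, c⟩ := b
    induction e with
    | _ u w =>
      simp only [Interaction.apply]
      by_cases hv : v ∈ s(u, w)
      · rw [if_pos hv]
        simp only [Sym2.map_mk, Sym2.sup_mk, Sym2.inf_mk, hx u v, hx w v, sup_idem, inf_idem,
          ite_self]
      · rw [if_neg hv]
  rwa [this]

theorem config_cons {G : SimpleGraph V} {m : ℕ} (x : V → Fin m) (b : Interaction G)
    (a : ℕ → Interaction G) (t : ℕ) :
    config x (consSeq b a) (t + 1) = config (b.apply x) a t := by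
  induction t with
  | zero => rfl
  | succ t ih =>
    rw [config, ih]
    rfl

theorem IsConsensus.config_mono {G : SimpleGraph V} {m : ℕ} {x : V → Fin m}
    {a : ℕ → Interaction G} {s t : ℕ} (h : IsConsensus (config x a s)) (hst : s ≤ t) :
    IsConsensus (config x a t) := by
  induction t, hst using Nat.le_induction with
  | base => exact h
  | succ t _ ih => exact ih.apply _

open scoped Classical in
/-- The indicator of the configurations without consensus. -/
def discord {m : ℕ} (x : V → Fin m) : ℝ≥0∞ := if IsConsensus x then 0 else 1

/-- Consensus is absorbing, so the discordant times form an initial segment of `ℕ`, whose length is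
the consensus time. -/
theorem consensusTime_eq_tsum {G : SimpleGraph V} {m : ℕ} (x : V → Fin m)
    (a : ℕ → Interaction G) :
    consensusTime x a = ∑' t : ℕ, discord (config x a t) := by
  classical
  unfold consensusTime
  by_cases h : ∃ t, IsConsensus (config x a t)
  · obtain ⟨N, hlt⟩ : ∃ N, ∀ t, IsConsensus (config x a t) ↔ N ≤ t := ⟨Nat.find h, fun t =>
      ⟨fun ht => Nat.find_min' h ht, fun ht => (Nat.find_spec h).config_mono ht⟩⟩
    simp only [discord, hlt]
    rw [tsum_eq_sum (s := Finset.range N)]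
    · rw [Finset.sum_congr rfl (g := fun _ => (1 : ℝ≥0∞))]
      · simp only [Finset.sum_const, Finset.card_range, nsmul_eq_mul, mul_one]
        refine le_antisymm (iInf₂_le N le_rfl) (le_iInf₂ fun t ht => by exact_mod_cast ht)
      · intro t ht
        rw [if_neg (by simpa using ht)]
    · intro t ht
      rw [if_pos (by simpa using ht)]
  · push Not at h
    simp [h, discord]

theorem measurable_config [Fintype V] {G : SimpleGraph V} {m : ℕ} (x : V → Fin m) (t : ℕ) :
    Measurable (fun a : ℕ → Interaction G => config x a t) := by
  induction t with
  | zero => exact measurable_const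
  | succ t ih =>
    have h : Measurable (fun q : Interaction G × (V → Fin m) => q.1.apply q.2) := by
      have : Finite (Interaction G) :=
        Finite.of_injective (fun b : Interaction G => (b.edge, b.higher)) (by
          rintro ⟨_, _⟩ ⟨_, _⟩ h
          simpa using h)
      have : MeasurableSingletonClass (Interaction G) := ⟨fun _ => trivial⟩
      exact measurable_of_finite _
    exact h.comp ((measurable_pi_apply t).prodMk ih)

open scoped Classical in
/-- The probability that consensus has not been reached by time `t` from the configuration `x`. -/
def survival [Fintype V] (G : SimpleGraph V) : ℕ → (V → Fin 2) → ℝ≥0∞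
  | 0, x => discord x
  | t + 1, x => (Fintype.card G.edgeSet : ℝ≥0∞)⁻¹ * ∑ e : G.edgeSet, survival G t (stepLow e x)

theorem lintegral_config [Fintype V] (G : SimpleGraph V) [Nonempty G.edgeSet] (t : ℕ)
    (x : V → Fin 2) : ∫⁻ a, discord (config x a t)
      ∂(Measure.infinitePi fun _ : ℕ => (interactionPMF G 0).toMeasure) = survival G t x := by
  classical
  induction t generalizing x with
  | zero =>
    simp only [config, survival, lintegral_const, measure_univ, mul_one]
  | succ t ih =>
    have hmeas : ∀ (y : V → Fin 2) (s : ℕ), Measurable fun a : ℕ → Interaction G =>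
        discord (config y a s) := fun y s =>
      (measurable_of_finite fun z : V → Fin 2 => discord z).comp (measurable_config y s)
    rw [← map_consSeq, lintegral_map (hmeas _ _) measurable_consSeq,
      lintegral_prod _ (by exact ((hmeas x (t + 1)).comp measurable_consSeq).aemeasurable)]
    simp only [config_cons, ih]
    rw [lintegral_interactionPMF_zero]
    rw [survival]
    congr!

open scoped Classical in
theorem expectedTimeZero_eq [Fintype V] (G : SimpleGraph V) [hG : Nonempty G.edgeSet] :
    expectedTimeZero G = ((2 : ℝ≥0∞) ^ Fintype.card V)⁻¹ *
      ∑ x : V → Fin 2, ∑' t : ℕ, survival G t x := by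
  classical
  have hmeas : ∀ (y : V → Fin 2) (s : ℕ), Measurable fun a : ℕ → Interaction G =>
      discord (config y a s) := fun y s =>
    (measurable_of_finite fun z : V → Fin 2 => discord z).comp (measurable_config y s)
  unfold expectedTimeZero expectedTime
  rw [dif_pos hG, processLaw]
  simp only [consensusTime_eq_tsum]
  rw [lintegral_prod, lintegral_fintype]
  · rw [Finset.mul_sum]
    refine Finset.sum_congr (by congr!) fun x _ => ?_
    rw [lintegral_tsum fun t => (hmeas x t).aemeasurable,
      PMF.toMeasure_apply_singleton _ _ (measurableSet_singleton x), PMF.uniformOfFintype_apply,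
      mul_comm]
    congr 1
    · simp
    · exact tsum_congr fun t => lintegral_config G t x
  · refine AEMeasurable.tsum fun t => Measurable.aemeasurable ?_
    refine measurable_from_prod_countable_right fun x => ?_
    exact hmeas x t

theorem survival_of_isConsensus [Fintype V] (G : SimpleGraph V) (t : ℕ) {x : V → Fin 2}
    (hx : IsConsensus x) : survival G t x = 0 := by
  induction t generalizing x with
  | zero => simp [survival, discord, hx]
  | succ t ih =>
    rw [survival, Finset.sum_eq_zero, mul_zero]
    exact fun e _ => ih (hx.apply _)

/-! ### Potential bounds for the mean time. -/

open scoped Classical in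
theorem sum_survival_succ [Fintype V] (G : SimpleGraph V) (N : ℕ) {x : V → Fin 2}
    (hx : ¬ IsConsensus x) : ∑ t ∈ Finset.range (N + 1), survival G t x =
      1 + (Fintype.card G.edgeSet : ℝ≥0∞)⁻¹ *
        ∑ e : G.edgeSet, ∑ t ∈ Finset.range N, survival G t (stepLow e x) := by
  rw [Finset.sum_range_succ', add_comm, Finset.sum_comm, Finset.mul_sum]
  congr 1
  simp [survival, discord, hx]

open scoped Classical in
theorem inv_card_mul_sum_ofReal [Fintype V] (G : SimpleGraph V) [Nonempty G.edgeSet]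
    {φ : G.edgeSet → ℝ} (hφ : ∀ e, 0 ≤ φ e) :
    (Fintype.card G.edgeSet : ℝ≥0∞)⁻¹ *
      ∑ e : G.edgeSet, ENNReal.ofReal (Fintype.card G.edgeSet * φ e) =
        ENNReal.ofReal (∑ e, φ e) := by
  rw [ENNReal.ofReal_sum_of_nonneg fun e _ => hφ e, Finset.mul_sum]
  refine Finset.sum_congr rfl fun e _ => ?_
  rw [ENNReal.ofReal_mul (by positivity), ENNReal.ofReal_natCast, ← mul_assoc,
    ENNReal.inv_mul_cancel (by simp) (by simp), one_mul]

open scoped Classical in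
-- The partial sums satisfy a first-step recursion that the potential, scaled by the number of
-- edges, dominates; induction on the number of terms.
theorem tsum_survival_le [Fintype V] (G : SimpleGraph V) [Nonempty G.edgeSet]
    {φ : (V → Fin 2) → ℝ} (hφ : ∀ x, 0 ≤ φ x)
    (h : ∀ x, ¬ IsConsensus x → 1 ≤ ∑ e : G.edgeSet, (φ x - φ (stepLow e x))) (x : V → Fin 2) :
    ∑' t, survival G t x ≤ ENNReal.ofReal (Fintype.card G.edgeSet * φ x) := by
  refine ENNReal.tsum_le_of_sum_range_le fun N => ?_
  induction N generalizing x with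
  | zero => simp
  | succ N ih =>
    by_cases hx : IsConsensus x
    · simp [survival_of_isConsensus G _ hx]
    · rw [sum_survival_succ G N hx]
      refine (add_le_add_right (mul_le_mul_right (Finset.sum_le_sum fun e _ =>
        ih (stepLow e x)) _) _).trans ?_
      rw [inv_card_mul_sum_ofReal G fun e => hφ _, ← ENNReal.ofReal_one,
        ← ENNReal.ofReal_add zero_le_one (Finset.sum_nonneg fun e _ => hφ _)]
      refine ENNReal.ofReal_le_ofReal ?_
      have := h x hx
      simp only [Finset.sum_sub_distrib, Finset.sum_const, Finset.card_univ, nsmul_eq_mul] at this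
      linarith

open scoped Classical in
-- Optional stopping with a remainder: after `N` steps the unspent potential has mean at most `K`
-- times the survival probability, where `K` bounds the scaled potential crudely by the sum of its
-- values. A finite mean time forces the remainder to zero.
theorem le_tsum_survival [Fintype V] (G : SimpleGraph V) [Nonempty G.edgeSet]
    {φ : (V → Fin 2) → ℝ} (hφ : ∀ x, 0 ≤ φ x) (hφ0 : ∀ x, IsConsensus x → φ x = 0)
    (h : ∀ x, ¬ IsConsensus x → ∑ e : G.edgeSet, (φ x - φ (stepLow e x)) ≤ 1) (x : V → Fin 2)
    (hx : ∑' t, survival G t x ≠ ⊤) :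
    ENNReal.ofReal (Fintype.card G.edgeSet * φ x) ≤ ∑' t, survival G t x := by
  set E := Fintype.card G.edgeSet
  set K : ℝ≥0∞ := ∑ y : V → Fin 2, ENNReal.ofReal (E * φ y)
  have key : ∀ (N : ℕ) (x : V → Fin 2), ENNReal.ofReal (E * φ x) ≤
      ∑ t ∈ Finset.range N, survival G t x + K * survival G N x := by
    intro N
    induction N with
    | zero =>
      intro x
      by_cases hx : IsConsensus x
      · simp [hφ0 x hx]
      · simp only [Finset.range_zero, Finset.sum_empty, survival, discord, hx, if_false, mul_one, zero_add]
        exact Finset.single_le_sum (f := fun y => ENNReal.ofReal (E * φ y))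
          (fun _ _ => zero_le) (Finset.mem_univ x)
    | succ N ih =>
      intro x
      by_cases hx : IsConsensus x
      · simp [hφ0 x hx]
      · rw [sum_survival_succ G N hx, survival, mul_left_comm, add_assoc, ← mul_add,
          Finset.mul_sum, ← Finset.sum_add_distrib]
        refine le_trans ?_ (add_le_add_right (mul_le_mul_right (Finset.sum_le_sum fun e _ =>
          ih (stepLow e x)) _) _)
        rw [inv_card_mul_sum_ofReal G fun e => hφ _, ← ENNReal.ofReal_one,
          ← ENNReal.ofReal_add zero_le_one (Finset.sum_nonneg fun e _ => hφ _)]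
        refine ENNReal.ofReal_le_ofReal ?_
        have := h x hx
        simp only [Finset.sum_sub_distrib, Finset.sum_const, Finset.card_univ,
          nsmul_eq_mul] at this
        linarith
  have hK : K ≠ ⊤ := ENNReal.sum_ne_top.2 fun _ _ => ENNReal.ofReal_ne_top
  have hlim : Tendsto (fun N => ∑' t, survival G t x + K * survival G N x) atTop
      (𝓝 (∑' t, survival G t x + K * 0)) :=
    tendsto_const_nhds.add (ENNReal.Tendsto.const_mul
      (ENNReal.tendsto_atTop_zero_of_tsum_ne_top hx) (Or.inr hK))
  rw [mul_zero, add_zero] at hlim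
  exact ge_of_tendsto' hlim fun N => (key N x).trans
    (add_le_add_left (ENNReal.sum_le_tsum _) _)

/-- The average of `φ` over the uniform configurations. -/
def average {ι : Type*} [Fintype ι] (φ : ι → ℝ) : ℝ := (Fintype.card ι : ℝ)⁻¹ * ∑ x, φ x

open scoped Classical in
theorem ofReal_card_mul_average [Fintype V] {φ : (V → Fin 2) → ℝ} (hφ : ∀ x, 0 ≤ φ x) (E : ℕ) :
    ENNReal.ofReal (E * average φ) =
      ((2 : ℝ≥0∞) ^ Fintype.card V)⁻¹ * ∑ x, ENNReal.ofReal (E * φ x) := by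
  rw [← ENNReal.ofReal_sum_of_nonneg fun x _ => mul_nonneg (Nat.cast_nonneg _) (hφ x),
    ← Finset.mul_sum, average, mul_left_comm, ENNReal.ofReal_mul (by positivity),
    ENNReal.ofReal_inv_of_pos (by positivity), ENNReal.ofReal_natCast]
  simp

open scoped Classical in
theorem expectedTimeZero_le_aux [Fintype V] (G : SimpleGraph V)
    {φ : (V → Fin 2) → ℝ} (hφ : ∀ x, 0 ≤ φ x)
    (h : ∀ x, ¬ IsConsensus x → 1 ≤ ∑ e : G.edgeSet, (φ x - φ (stepLow e x))) :
    expectedTimeZero G ≤ ENNReal.ofReal (numEdges G * average φ) := by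
  by_cases hG : Nonempty G.edgeSet
  · rw [expectedTimeZero_eq, numEdges, Nat.card_eq_fintype_card, ofReal_card_mul_average hφ]
    gcongr with x
    exact tsum_survival_le G hφ h x
  · simp [expectedTimeZero, expectedTime, hG]

open scoped Classical in
theorem le_expectedTimeZero_aux [Fintype V] (G : SimpleGraph V)
    {φ : (V → Fin 2) → ℝ} (hφ : ∀ x, 0 ≤ φ x) (hφ0 : ∀ x, IsConsensus x → φ x = 0)
    (h : ∀ x, ¬ IsConsensus x → ∑ e : G.edgeSet, (φ x - φ (stepLow e x)) ≤ 1)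
    (hfin : expectedTimeZero G ≠ ⊤) :
    ENNReal.ofReal (numEdges G * average φ) ≤ expectedTimeZero G := by
  by_cases hG : Nonempty G.edgeSet
  · rw [expectedTimeZero_eq] at hfin ⊢
    rw [numEdges, Nat.card_eq_fintype_card, ofReal_card_mul_average hφ]
    gcongr with x
    refine le_tsum_survival G hφ hφ0 h x fun htop => hfin ?_
    rw [ENNReal.sum_eq_top.2 ⟨x, Finset.mem_univ x, htop⟩]
    exact ENNReal.mul_top (ENNReal.inv_ne_zero.2 (by finiteness))
  · have : IsEmpty G.edgeSet := not_nonempty_iff.1 hG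
    simp [numEdges]

theorem expectedTimeZero_le [Fintype V] [DecidableEq V] (G : SimpleGraph V) [Fintype G.edgeSet]
    {φ : (V → Fin 2) → ℝ} (hφ : ∀ x, 0 ≤ φ x)
    (h : ∀ x, ¬ IsConsensus x → 1 ≤ ∑ e : G.edgeSet, (φ x - φ (stepLow e x))) :
    expectedTimeZero G ≤ ENNReal.ofReal (numEdges G * average φ) := by
  convert expectedTimeZero_le_aux G hφ fun x hx => ?_
  convert h x hx

theorem le_expectedTimeZero [Fintype V] [DecidableEq V] (G : SimpleGraph V) [Fintype G.edgeSet]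
    {φ : (V → Fin 2) → ℝ} (hφ : ∀ x, 0 ≤ φ x) (hφ0 : ∀ x, IsConsensus x → φ x = 0)
    (h : ∀ x, ¬ IsConsensus x → ∑ e : G.edgeSet, (φ x - φ (stepLow e x)) ≤ 1)
    (hfin : expectedTimeZero G ≠ ⊤) :
    ENNReal.ofReal (numEdges G * average φ) ≤ expectedTimeZero G := by
  convert le_expectedTimeZero_aux G hφ hφ0 (fun x hx => ?_) hfin
  convert h x hx

/-! ### Cliques with pendant trees -/

variable {V : Type*}

theorem stepLow_le {G : SimpleGraph V} (e : G.edgeSet) (x : V → Fin 2) : stepLow e x ≤ x := by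
  classical
  intro v
  obtain ⟨e, he⟩ := e
  induction e with
  | _ a b =>
    rw [stepLow_mk he x v]
    split_ifs with h
    · rcases h with rfl | rfl
      · exact inf_le_left
      · exact inf_le_right
    · exact le_rfl

theorem stepLow_eq_zero {G : SimpleGraph V} (e : G.edgeSet) {x : V → Fin 2} {v : V}
    (h : x v = 0) : stepLow e x v = 0 :=
  le_antisymm ((stepLow_le e x v).trans h.le) (Fin.zero_le _)

theorem stepLow_of_ne {G : SimpleGraph V} {a b : V} (h : s(a, b) ∈ G.edgeSet) (x : V → Fin 2)
    {v : V} (ha : v ≠ a) (hb : v ≠ b) : stepLow ⟨s(a, b), h⟩ x v = x v := by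
  classical
  rw [stepLow_mk h x v, if_neg (by tauto)]

theorem stepLow_right {G : SimpleGraph V} {a b : V} (h : s(a, b) ∈ G.edgeSet) (x : V → Fin 2) :
    stepLow ⟨s(a, b), h⟩ x b = x a ⊓ x b := by
  classical
  rw [stepLow_mk h x b, if_pos (Or.inr rfl)]

theorem stepLow_left {G : SimpleGraph V} {a b : V} (h : s(a, b) ∈ G.edgeSet) (x : V → Fin 2) :
    stepLow ⟨s(a, b), h⟩ x a = x a ⊓ x b := by
  classical
  rw [stepLow_mk h x a, if_pos (Or.inl rfl)]

/-- The graph `G` consists of a clique on the vertices `inl a`, and of one further edge from every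
vertex `inr j` to a clique vertex or to an earlier vertex `att j`. -/
structure IsCliqueTree {m r : ℕ} (G : SimpleGraph (Fin m ⊕ Fin r))
    (att : Fin r → Fin m ⊕ Fin r) : Prop where
  adj_inl : ∀ a b, G.Adj (.inl a) (.inl b) ↔ a ≠ b
  adj_inr : ∀ u j, G.Adj u (.inr j) ↔ u = att j ∨ ∃ i, u = .inr i ∧ att i = .inr j
  lt_of_att : ∀ i j, att j = .inr i → i < j

namespace IsCliqueTree

variable {m r : ℕ} {G : SimpleGraph (Fin m ⊕ Fin r)} {att : Fin r → Fin m ⊕ Fin r}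

theorem mem_edgeSet (hG : IsCliqueTree G att) (j : Fin r) : s(att j, .inr j) ∈ G.edgeSet :=
  (hG.adj_inr _ _).2 (Or.inl rfl)

/-- The edge that attaches the vertex `inr j`. -/
def pendant (hG : IsCliqueTree G att) (j : Fin r) : G.edgeSet := ⟨s(att j, .inr j), hG.mem_edgeSet j⟩

theorem map_inl_mem (hG : IsCliqueTree G att) {e : Sym2 (Fin m)}
    (he : e ∈ (⊤ : SimpleGraph (Fin m)).edgeSet) : e.map Sum.inl ∈ G.edgeSet := by
  induction e with
  | _ a b => exact (hG.adj_inl a b).2 he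

/-- The edges of a clique with pendant trees. -/
def edgeMap (hG : IsCliqueTree G att) :
    (⊤ : SimpleGraph (Fin m)).edgeSet ⊕ Fin r → G.edgeSet :=
  Sum.elim (fun e => ⟨e.1.map Sum.inl, hG.map_inl_mem e.2⟩) hG.pendant

theorem bijective_edgeMap (hG : IsCliqueTree G att) : Function.Bijective hG.edgeMap := by
  constructor
  · rintro (⟨e, he⟩ | i) (⟨f, hf⟩ | j) h
    · have h' : e.map (Sum.inl : Fin m → Fin m ⊕ Fin r) = f.map Sum.inl := congrArg Subtype.val h
      rw [Sum.inl.injEq, Subtype.mk.injEq]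
      exact Sym2.map.injective Sum.inl_injective h'
    · have h' : e.map (Sum.inl : Fin m → Fin m ⊕ Fin r) = s(att j, .inr j) :=
        congrArg Subtype.val h
      have : (Sum.inr j : Fin m ⊕ Fin r) ∈ e.map Sum.inl := h' ▸ Sym2.mem_mk_right _ _
      simp at this
    · have h' : s(att i, .inr i) = f.map (Sum.inl : Fin m → Fin m ⊕ Fin r) :=
        congrArg Subtype.val h
      have : (Sum.inr i : Fin m ⊕ Fin r) ∈ f.map Sum.inl := h' ▸ Sym2.mem_mk_right _ _
      simp at this
    · have h' : s(att i, .inr i) = s(att j, .inr j) := congrArg Subtype.val h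
      rw [Sym2.eq_iff] at h'
      rcases h' with ⟨_, h'⟩ | ⟨h1, h2⟩
      · rw [Sum.inr.inj h']
      -- Each of the two vertices would be attached to the other, against the ordering.
      · exact absurd (hG.lt_of_att _ _ h1) (hG.lt_of_att _ _ h2.symm).asymm
  · rintro ⟨e, he⟩
    induction e with
    | _ u v =>
      have key : ∀ (u) (j : Fin r) (h : s(u, .inr j) ∈ G.edgeSet),
          ∃ d, hG.edgeMap d = ⟨s(u, .inr j), h⟩ := by
        intro u j h
        rcases (hG.adj_inr u j).1 h with rfl | ⟨i, rfl, hi⟩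
        · exact ⟨.inr j, rfl⟩
        · refine ⟨.inr i, Subtype.ext ?_⟩
          simp [edgeMap, pendant, hi, Sym2.eq_swap]
      rcases v with b | j
      · rcases u with a | i
        · exact ⟨.inl ⟨s(a, b), (hG.adj_inl a b).1 he⟩, rfl⟩
        · obtain ⟨d, hd⟩ := key (.inl b) i (by rwa [Sym2.eq_swap])
          exact ⟨d, hd.trans (Subtype.ext Sym2.eq_swap)⟩
      · exact key u j he

theorem numEdges_eq (hG : IsCliqueTree G att) :
    numEdges G = Nat.card ((⊤ : SimpleGraph (Fin m)).edgeSet ⊕ Fin r) :=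
  (Nat.card_congr (Equiv.ofBijective _ hG.bijective_edgeMap)).symm

theorem sum_edgeSet (hG : IsCliqueTree G att) [Fintype G.edgeSet] (g : G.edgeSet → ℝ) :
    ∑ e, g e = ∑ e : (⊤ : SimpleGraph (Fin m)).edgeSet, g ⟨e.1.map Sum.inl, hG.map_inl_mem e.2⟩ +
      ∑ j, g (hG.pendant j) := by
  rw [← (Equiv.ofBijective _ hG.bijective_edgeMap).sum_comp, Fintype.sum_sum_type]
  rfl

theorem stepLow_clique_inr (hG : IsCliqueTree G att)
    (e : (⊤ : SimpleGraph (Fin m)).edgeSet) (x : Fin m ⊕ Fin r → Fin 2) (j : Fin r) :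
    stepLow (⟨e.1.map Sum.inl, hG.map_inl_mem e.2⟩ : G.edgeSet) x (.inr j) = x (.inr j) := by
  obtain ⟨e, he⟩ := e
  induction e with
  | _ a b => exact stepLow_of_ne (hG.map_inl_mem he) x (by simp) (by simp)

end IsCliqueTree

/-! ### The time to fill the clique -/

/-- The expected time, in units of the number of edges, in which a clique of size `m` with `c` low
vertices is filled. -/
def fillTime (m c : ℕ) : ℝ := ∑ j ∈ Finset.Ico c m, ((j : ℝ) * (m - j))⁻¹

theorem fillTime_nonneg (m c : ℕ) : 0 ≤ fillTime m c := by
  refine Finset.sum_nonneg fun j hj => ?_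
  have : (j : ℝ) ≤ m := by exact_mod_cast (Finset.mem_Ico.1 hj).2.le
  have : (0 : ℝ) ≤ m - j := by linarith
  positivity

theorem fillTime_antitone (m : ℕ) : Antitone (fillTime m) := by
  intro c d hcd
  refine Finset.sum_le_sum_of_subset_of_nonneg (Finset.Ico_subset_Ico_left hcd) fun j hj _ => ?_
  have : (j : ℝ) ≤ m := by exact_mod_cast (Finset.mem_Ico.1 hj).2.le
  have : (0 : ℝ) ≤ m - j := by linarith
  positivity

/-- For `c = 0` both sides are zero, because `0⁻¹ = 0`. -/
theorem fillTime_sub {m c : ℕ} (hc : c < m) :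
    fillTime m c - fillTime m (c + 1) = ((c : ℝ) * (m - c))⁻¹ := by
  rw [fillTime, fillTime, Finset.sum_eq_sum_Ico_succ_bot hc, add_sub_cancel_right]

/-- Partial fractions: `1 / (j * (m + 1 - j))` is `1 / (m + 1)` times `1 / j + 1 / (m + 1 - j)`, and
the two sums agree by reflection. -/
theorem fillTime_one (m : ℕ) : fillTime (m + 1) 1 = 2 / (m + 1) * (harmonic m : ℝ) := by
  have h : ∀ j ∈ Finset.range m, (((1 + j : ℕ) : ℝ) * ((m + 1 : ℕ) - (1 + j : ℕ)))⁻¹ =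
      ((m : ℝ) + 1)⁻¹ * (((j + 1 : ℕ) : ℝ)⁻¹ + ((m - 1 - j + 1 : ℕ) : ℝ)⁻¹) := by
    intro j hj
    have hj : j < m := Finset.mem_range.1 hj
    obtain ⟨k, rfl⟩ := Nat.exists_eq_add_of_lt hj
    have : j + k + 1 - 1 - j + 1 = k + 1 := by omega
    rw [this]
    push_cast
    have h2 : (j : ℝ) + k + 1 + 1 - (1 + j) = k + 1 := by ring
    rw [h2]
    field_simp
    ring
  rw [fillTime, Finset.sum_Ico_eq_sum_range, Nat.add_sub_cancel, Finset.sum_congr rfl h,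
    ← Finset.mul_sum, Finset.sum_add_distrib,
    Finset.sum_range_reflect (fun j => ((j + 1 : ℕ) : ℝ)⁻¹), harmonic]
  push_cast
  field_simp
  ring

theorem tendsto_fillTime_one : Tendsto (fun m => fillTime m 1) atTop (𝓝 0) := by
  rw [← tendsto_add_atTop_iff_nat 1]
  have h1 : Tendsto (fun m : ℕ => (Real.log m + 1) / m) atTop (𝓝 0) := by
    have := (Real.isLittleO_log_id_atTop.tendsto_div_nhds_zero.comp tendsto_natCast_atTop_atTop).add
      (tendsto_one_div_atTop_nhds_zero_nat : Tendsto (fun n : ℕ => 1 / (n : ℝ)) atTop (𝓝 0))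
    simpa [Function.comp_def, add_div] using this
  have h2 := (h1.const_mul 2)
  rw [mul_zero] at h2
  refine tendsto_of_tendsto_of_tendsto_of_le_of_le' tendsto_const_nhds h2
    (Eventually.of_forall fun m => fillTime_nonneg _ _) ?_
  filter_upwards [eventually_gt_atTop 0] with m hm
  have hm' : (0 : ℝ) < m := by exact_mod_cast hm
  rw [fillTime_one]
  have h3 : (harmonic m : ℝ) ≤ 1 + Real.log m := harmonic_le_one_add_log m
  have h4 : 0 ≤ Real.log m := Real.log_natCast_nonneg m
  calc 2 / ((m : ℝ) + 1) * (harmonic m : ℝ) ≤ 2 / ((m : ℝ)) * (1 + Real.log m) := by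
        refine mul_le_mul ?_ h3 ?_ (by positivity)
        · gcongr
          linarith
        · rw [harmonic]
          push_cast
          positivity
    _ = 2 * ((Real.log m + 1) / m) := by ring

/-- The set of low vertices of the clique. -/
def lowSet {m r : ℕ} (x : Fin m ⊕ Fin r → Fin 2) : Finset (Fin m) :=
  Finset.univ.filter fun a => x (.inl a) = 0

theorem mem_lowSet {m r : ℕ} {x : Fin m ⊕ Fin r → Fin 2} {a : Fin m} :
    a ∈ lowSet x ↔ x (.inl a) = 0 := by
  simp [lowSet]

/-- The contribution of the clique to the bound for the expected time; `d` bounds the time until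
the clique has a low vertex. -/
def cliquePart {m r : ℕ} (d : (Fin m ⊕ Fin r → Fin 2) → ℝ) (x : Fin m ⊕ Fin r → Fin 2) : ℝ :=
  if (lowSet x).card = 0 then fillTime m 1 + 1 + d x else fillTime m (lowSet x).card

theorem card_lowSet_mono {m r : ℕ} {x y : Fin m ⊕ Fin r → Fin 2} (h : x ≤ y) :
    (lowSet y).card ≤ (lowSet x).card :=
  Finset.card_le_card fun _ ha => mem_lowSet.2
    (le_antisymm ((h _).trans (mem_lowSet.1 ha).le) (Fin.zero_le _))

theorem cliquePart_step {m r : ℕ} {G : SimpleGraph (Fin m ⊕ Fin r)}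
    {d : (Fin m ⊕ Fin r → Fin 2) → ℝ} (hd0 : ∀ x, 0 ≤ d x)
    (hd : ∀ (e : G.edgeSet) x, d (stepLow e x) ≤ d x) (e : G.edgeSet) (x) :
    cliquePart d (stepLow e x) ≤ cliquePart d x := by
  have h1 := card_lowSet_mono (stepLow_le e x)
  have h2 := hd e x
  have h3 := hd0 x
  unfold cliquePart
  split_ifs with ha hb hb
  · linarith
  · omega
  · have := fillTime_antitone m (Nat.one_le_iff_ne_zero.2 ha)
    linarith
  · exact fillTime_antitone m h1

theorem cliquePart_nonneg {m r : ℕ} {d : (Fin m ⊕ Fin r → Fin 2) → ℝ} (hd0 : ∀ x, 0 ≤ d x) (x) :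
    0 ≤ cliquePart d x := by
  have h1 := fillTime_nonneg m 1
  have h2 := hd0 x
  unfold cliquePart
  split_ifs
  · linarith
  · exact fillTime_nonneg _ _

theorem eq_one_of_ne_zero {a : Fin 2} (h : a ≠ 0) : a = 1 := by omega

theorem lowSet_stepLow {m r : ℕ} {G : SimpleGraph (Fin m ⊕ Fin r)} {a b : Fin m}
    (h : s(.inl a, .inl b) ∈ G.edgeSet) {x : Fin m ⊕ Fin r → Fin 2} (ha : a ∈ lowSet x) :
    lowSet (stepLow ⟨_, h⟩ x) = insert b (lowSet x) := by
  ext v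
  rw [Finset.mem_insert, mem_lowSet, mem_lowSet]
  have ha := mem_lowSet.1 ha
  by_cases hb : v = b
  · subst hb
    rw [stepLow_right, ha]
    simp
  · by_cases hva : v = a
    · subst hva
      rw [stepLow_left, ha]
      simp
    · rw [stepLow_of_ne _ _ (by simpa using hva) (by simpa using hb)]
      simp [hb]

/-- With `c` low vertices in the clique, the `c * (m - c)` edges from low to high each lower the
potential by `1 / (c * (m - c))`; no other edge raises it. -/
theorem one_le_sum_cliquePart {m r : ℕ} {G : SimpleGraph (Fin m ⊕ Fin r)} [Fintype G.edgeSet]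
    (hG : ∀ a b, a ≠ b → G.Adj (.inl a) (.inl b))
    {d : (Fin m ⊕ Fin r → Fin 2) → ℝ} (hd0 : ∀ x, 0 ≤ d x)
    (hd : ∀ (e : G.edgeSet) x, d (stepLow e x) ≤ d x) (x : Fin m ⊕ Fin r → Fin 2)
    (h0 : (lowSet x).card ≠ 0) (hm : (lowSet x).card ≠ m) :
    1 ≤ ∑ e : G.edgeSet, (cliquePart d x - cliquePart d (stepLow e x)) := by
  set c := (lowSet x).card with hc
  have hcm : c < m := lt_of_le_of_ne ((Finset.card_le_univ _).trans_eq (Fintype.card_fin m)) hm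
  have hne : ∀ p : (lowSet x ×ˢ (lowSet x)ᶜ : Finset (Fin m × Fin m)), p.1.1 ≠ p.1.2 := by
    rintro ⟨⟨a, b⟩, hp⟩ h
    simp only [Finset.mem_product, Finset.mem_compl] at hp
    exact hp.2 ((show a = b from h) ▸ hp.1)
  let f : (lowSet x ×ˢ (lowSet x)ᶜ : Finset (Fin m × Fin m)) → G.edgeSet :=
    fun p => ⟨s(.inl p.1.1, .inl p.1.2), hG _ _ (hne p)⟩
  have hf : Function.Injective f := by
    rintro ⟨⟨a, b⟩, hp⟩ ⟨⟨a', b'⟩, hp'⟩ h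
    have h' : s((Sum.inl a : Fin m ⊕ Fin r), .inl b) = s(.inl a', .inl b') :=
      congrArg Subtype.val h
    simp only [Finset.mem_product, Finset.mem_compl] at hp hp'
    simp only [Sym2.eq_iff, Sum.inl.injEq] at h'
    rcases h' with ⟨rfl, rfl⟩ | ⟨rfl, rfl⟩
    · rfl
    · exact absurd hp.1 hp'.2
  have hdec : ∀ p, cliquePart d x - cliquePart d (stepLow (f p) x) = ((c : ℝ) * (m - c))⁻¹ := by
    intro p
    obtain ⟨⟨a, b⟩, hp⟩ := p
    have hab := hne ⟨⟨a, b⟩, hp⟩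
    simp only [Finset.mem_product, Finset.mem_compl] at hp
    have hlow : lowSet (stepLow (f ⟨(a, b), _⟩) x) = insert b (lowSet x) :=
      lowSet_stepLow (hG _ _ hab) hp.1
    rw [cliquePart, cliquePart, hlow, Finset.card_insert_of_notMem hp.2, ← hc, if_neg h0,
      if_neg (Nat.succ_ne_zero c), fillTime_sub hcm]
  calc (1 : ℝ) = ∑ p, (cliquePart d x - cliquePart d (stepLow (f p) x)) := by
        have h1 : (0 : ℝ) < c := by exact_mod_cast Nat.pos_of_ne_zero h0
        have h2 : (0 : ℝ) < m - c := by
          rw [sub_pos]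
          exact_mod_cast hcm
        simp only [hdec, Finset.sum_const, Finset.card_univ, Fintype.card_coe,
          Finset.card_product, Finset.card_compl, Fintype.card_fin, nsmul_eq_mul, ← hc]
        rw [Nat.cast_mul, Nat.cast_sub hcm.le, mul_inv_cancel₀ (by positivity)]
    _ = ∑ e ∈ Finset.univ.map ⟨f, hf⟩, (cliquePart d x - cliquePart d (stepLow e x)) := by
        rw [Finset.sum_map]
        rfl
    _ ≤ _ := Finset.sum_le_univ_sum_of_nonneg fun e =>
        sub_nonneg.2 (cliquePart_step hd0 hd e x)

/-- Each regime is paid for by a different term, all terms being nonincreasing: `d` and the extra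
`1` while the clique has no low vertex, `fillTime` while it is mixed, and `B` once it is all low. -/
theorem expectedTimeZero_le_clique {m r : ℕ} {G : SimpleGraph (Fin m ⊕ Fin r)} [Fintype G.edgeSet]
    (hG : ∀ a b, a ≠ b → G.Adj (.inl a) (.inl b))
    {B d : (Fin m ⊕ Fin r → Fin 2) → ℝ} (hB0 : ∀ x, 0 ≤ B x)
    (hB : ∀ (e : G.edgeSet) x, B (stepLow e x) ≤ B x) (hd0 : ∀ x, 0 ≤ d x)
    (hd : ∀ (e : G.edgeSet) x, d (stepLow e x) ≤ d x)
    (hfull : ∀ x, ¬ IsConsensus x → (∀ a, x (.inl a) = 0) →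
      1 ≤ ∑ e : G.edgeSet, (B x - B (stepLow e x)))
    (hempty : ∀ x, ¬ IsConsensus x → (∀ a, x (.inl a) = 1) →
      ∃ e : G.edgeSet, (∃ a, stepLow e x (.inl a) = 0) ∨ d (stepLow e x) + 1 ≤ d x) :
    expectedTimeZero G ≤ ENNReal.ofReal
      (numEdges G * average (fun x => B x + cliquePart d x)) := by
  refine expectedTimeZero_le G (φ := fun x => B x + cliquePart d x)
    (fun x => add_nonneg (hB0 x) (cliquePart_nonneg hd0 x)) fun x hx => ?_
  have hsplit : ∑ e : G.edgeSet, (B x + cliquePart d x - (B (stepLow e x) +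
      cliquePart d (stepLow e x))) = ∑ e : G.edgeSet, (B x - B (stepLow e x)) +
      ∑ e : G.edgeSet, (cliquePart d x - cliquePart d (stepLow e x)) := by
    simp only [Finset.sum_add_distrib, Finset.sum_sub_distrib]
    ring
  have hBs : 0 ≤ ∑ e : G.edgeSet, (B x - B (stepLow e x)) :=
    Finset.sum_nonneg fun e _ => sub_nonneg.2 (hB e x)
  have hcs : ∀ e ∈ Finset.univ, 0 ≤ cliquePart d x - cliquePart d (stepLow e x) :=
    fun e _ => sub_nonneg.2 (cliquePart_step hd0 hd e x)
  rw [hsplit]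
  by_cases h0 : (lowSet x).card = 0
  · have hall : ∀ a, x (.inl a) = 1 := fun a => eq_one_of_ne_zero fun ha => by
      have := mem_lowSet.2 ha
      rw [Finset.card_eq_zero.1 h0] at this
      simp at this
    obtain ⟨e, he⟩ := hempty x hx hall
    suffices h : 1 ≤ cliquePart d x - cliquePart d (stepLow e x) from
      (h.trans (Finset.single_le_sum hcs (Finset.mem_univ e))).trans
        (le_add_of_nonneg_left hBs)
    have h3 := hd0 x
    have h4 := hd e x
    rw [cliquePart, if_pos h0, cliquePart]
    split_ifs with h1
    · rcases he with ⟨a, ha⟩ | he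
      · have := mem_lowSet.2 ha
        rw [Finset.card_eq_zero.1 h1] at this
        simp at this
      · linarith
    · have := fillTime_antitone m (Nat.one_le_iff_ne_zero.2 h1)
      linarith
  · by_cases hm : (lowSet x).card = m
    · have hall : ∀ a, x (.inl a) = 0 := fun a => by
        rw [← mem_lowSet, (Finset.card_eq_iff_eq_univ _).1 (hm.trans (Fintype.card_fin m).symm)]
        exact Finset.mem_univ a
      exact (hfull x hx hall).trans (le_add_of_nonneg_right (Finset.sum_nonneg hcs))
    · exact (one_le_sum_cliquePart hG hd0 hd x h0 hm).trans (le_add_of_nonneg_left hBs)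

/-! ### Averages -/

theorem average_add {ι : Type*} [Fintype ι] (f g : ι → ℝ) :
    average (fun x => f x + g x) = average f + average g := by
  simp only [average, Finset.sum_add_distrib, mul_add]

theorem average_mono {ι : Type*} [Fintype ι] {f g : ι → ℝ} (h : ∀ x, f x ≤ g x) :
    average f ≤ average g :=
  mul_le_mul_of_nonneg_left (Finset.sum_le_sum fun x _ => h x) (by positivity)

theorem average_const {ι : Type*} [Fintype ι] [Nonempty ι] (c : ℝ) :
    average (fun _ : ι => c) = c := by
  simp [average]

theorem average_prod {m r : ℕ} (f : (Fin m → Fin 2) → ℝ) (g : (Fin r → Fin 2) → ℝ) :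
    average (fun x : Fin m ⊕ Fin r → Fin 2 => f (fun a => x (.inl a)) * g (fun j => x (.inr j))) =
      average f * average g := by
  have h := (Equiv.sumArrowEquivProdArrow (Fin m) (Fin r) (Fin 2)).sum_comp
    (fun p => f p.1 * g p.2)
  rw [Fintype.sum_prod_type, ← Finset.sum_mul_sum] at h
  simp only [average]
  rw [show (∑ x : Fin m ⊕ Fin r → Fin 2, f (fun a => x (.inl a)) * g (fun j => x (.inr j))) =
    (∑ i, f i) * ∑ j, g j from h]
  simp only [Fintype.card_fun, Fintype.card_sum, Fintype.card_fin, pow_add]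
  push_cast
  field_simp

theorem average_inr {m r : ℕ} (g : (Fin r → Fin 2) → ℝ) :
    average (fun x : Fin m ⊕ Fin r → Fin 2 => g (fun j => x (.inr j))) = average g := by
  have := average_prod (m := m) (fun _ => 1) g
  rw [average_const, one_mul] at this
  simpa using this

theorem average_eq_one (ι : Type*) [Fintype ι] [DecidableEq ι]
    [∀ x : ι → Fin 2, Decidable (∀ a, x a = 1)] :
    average (fun x : ι → Fin 2 => if ∀ a, x a = 1 then (1 : ℝ) else 0) =
      (2 ^ Fintype.card ι)⁻¹ := by
  have : ∀ x : ι → Fin 2, (∀ a, x a = 1) ↔ x = fun _ => 1 := fun x => by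
    rw [funext_iff]
  simp [average, this]

/-- The terms `1 + d` occur only if the clique is all high, an event of probability `2 ^ (-m)` that
is independent of the pendant vertices. -/
theorem average_cliquePart_le {m r : ℕ} {d : (Fin r → Fin 2) → ℝ} (hd0 : ∀ y, 0 ≤ d y) :
    average (cliquePart (m := m) fun x => d fun j => x (.inr j)) ≤
      fillTime m 1 + (2 ^ m)⁻¹ * (1 + average d) := by
  have h1 : ∀ x : Fin m ⊕ Fin r → Fin 2, cliquePart (fun x => d fun j => x (.inr j)) x ≤
      fillTime m 1 + (if ∀ a, x (.inl a) = 1 then (1 : ℝ) else 0) *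
        (1 + d fun j => x (.inr j)) := by
    intro x
    unfold cliquePart
    split_ifs with h h' h'
    · linarith
    · exfalso
      refine h' fun a => eq_one_of_ne_zero fun ha => ?_
      have := mem_lowSet.2 ha
      rw [Finset.card_eq_zero.1 h] at this
      simp at this
    · have := fillTime_antitone m (Nat.one_le_iff_ne_zero.2 h)
      have := hd0 fun j => x (.inr j)
      linarith
    · have := fillTime_antitone m (Nat.one_le_iff_ne_zero.2 h)
      linarith
  refine (average_mono h1).trans_eq ?_
  rw [average_add, average_const,
    average_prod (fun x => if ∀ a, x a = 1 then (1 : ℝ) else 0) (fun y => 1 + d y),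
    average_eq_one, average_add, average_const, Fintype.card_fin]

/-! ### The sundew and the lollipop as cliques with pendant trees -/

/-- The clique vertex to which the pendant vertex `inr j` of the sundew is attached. -/
def sundewAtt {n r : ℕ} (h : r < n) (j : Fin r) : Fin (n - r) ⊕ Fin r :=
  .inl ⟨(j : ℕ) % (n - r), Nat.mod_lt _ (Nat.sub_pos_of_lt h)⟩

/-- The vertex that precedes the path vertex `inr j` of the lollipop. -/
def lollipopAtt {n r : ℕ} (h : r < n) (j : Fin r) : Fin (n - r) ⊕ Fin r :=
  if (j : ℕ) = 0 then .inl ⟨0, Nat.sub_pos_of_lt h⟩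
  else .inr ⟨(j : ℕ) - 1, (Nat.sub_le _ _).trans_lt j.2⟩

theorem isCliqueTree_sundew {n r : ℕ} (h : r < n) :
    IsCliqueTree (sundew n r) (sundewAtt h) where
  adj_inl a b := by simp [sundew]
  adj_inr u j := by
    rcases u with a | i
    · simp [sundew, sundewAtt, Fin.ext_iff]
    · simp [sundew, sundewAtt]
  lt_of_att i j := by simp [sundewAtt]

theorem isCliqueTree_lollipop {n r : ℕ} (h : r < n) :
    IsCliqueTree (lollipop n r) (lollipopAtt h) where
  adj_inl a b := by simp [lollipop]
  adj_inr u j := by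
    rcases u with a | i
    · by_cases hj : (j : ℕ) = 0 <;> simp [lollipop, lollipopAtt, hj, Fin.ext_iff]
    · have h1 : ((Sum.inr i : Fin (n - r) ⊕ Fin r) = lollipopAtt h j) ↔ (j : ℕ) = i + 1 := by
        unfold lollipopAtt
        split_ifs with hj
        · simp [hj]
        · simp only [Sum.inr.injEq, Fin.ext_iff]
          omega
      have h2 : (∃ k, (Sum.inr i : Fin (n - r) ⊕ Fin r) = .inr k ∧ lollipopAtt h k = .inr j) ↔
          (i : ℕ) = j + 1 := by
        simp only [Sum.inr.injEq, exists_eq_left']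
        unfold lollipopAtt
        split_ifs with hj
        · simp [hj]
        · simp only [Sum.inr.injEq, Fin.ext_iff]
          omega
      rw [h1, h2]
      simp only [lollipop, SimpleGraph.fromRel_adj, ne_eq, Sum.inr.injEq, Fin.ext_iff]
      omega
  lt_of_att i j := by
    unfold lollipopAtt
    split_ifs with hj
    · simp
    · simp only [Sum.inr.injEq, Fin.ext_iff, Fin.lt_def]
      omega

theorem numEdges_sundew_eq {n r : ℕ} (h : r < n) :
    numEdges (sundew n r) = numEdges (lollipop n r) := by
  rw [(isCliqueTree_sundew h).numEdges_eq, (isCliqueTree_lollipop h).numEdges_eq]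

/-! ### Averages over binary strings -/

theorem average_succ {r : ℕ} (f : (Fin (r + 1) → Fin 2) → ℝ) :
    average f = (average (fun y : Fin r → Fin 2 => f (Fin.cons 0 y)) +
      average (fun y : Fin r → Fin 2 => f (Fin.cons 1 y))) / 2 := by
  have h := (Fin.consEquiv (fun _ : Fin (r + 1) => Fin 2)).sum_comp f
  rw [Fintype.sum_prod_type, Fin.sum_univ_two] at h
  simp only [average, ← h, Fintype.card_fun, Fintype.card_fin, pow_succ]
  push_cast
  field_simp
  rfl

theorem average_of_isEmpty (f : (Fin 0 → Fin 2) → ℝ) : average f = f Fin.elim0 := by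
  have h : f = fun _ => f Fin.elim0 := funext fun y => congrArg f (Subsingleton.elim _ _)
  rw [h, average_const]

/-- The number of high entries. -/
def highCount {r : ℕ} (y : Fin r → Fin 2) : ℕ := ∑ j, (y j : ℕ)

theorem average_highCount (r : ℕ) (g : ℕ → ℝ) :
    average (fun y : Fin r → Fin 2 => g (highCount y)) =
      (2 ^ r)⁻¹ * ∑ j ∈ Finset.range (r + 1), (r.choose j : ℝ) * g j := by
  induction r generalizing g with
  | zero => simp [average_of_isEmpty, highCount]
  | succ r ih =>
    have h0 : ∀ y : Fin r → Fin 2, highCount (Fin.cons 0 y : Fin (r + 1) → Fin 2) =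
        highCount y := fun y => by simp [highCount, Fin.sum_univ_succ]
    have h1 : ∀ y : Fin r → Fin 2, highCount (Fin.cons 1 y : Fin (r + 1) → Fin 2) =
        highCount y + 1 := fun y => by simp [highCount, Fin.sum_univ_succ, add_comm]
    rw [average_succ]
    simp only [h0, h1]
    rw [ih g, ih fun j => g (j + 1), Finset.sum_range_succ' _ (r + 1)]
    simp only [Nat.choose_succ_succ, Nat.cast_add, add_mul, Finset.sum_add_distrib]
    rw [Finset.sum_range_succ (fun j => (r.choose (j + 1) : ℝ) * g (j + 1)) r,
      Finset.sum_range_succ' (fun j => (r.choose j : ℝ) * g j) r]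
    simp only [Nat.choose_succ_self, Nat.choose_zero_right, pow_succ]
    push_cast
    field_simp
    ring

/-- The average of the harmonic numbers under the binomial distribution with parameters `r`
and `1 / 2`. -/
def binomialHarmonic (r : ℕ) : ℝ :=
  ∑ j ∈ Finset.range r, (1 - (2 ^ (j + 1))⁻¹) / ((j : ℝ) + 1)

/-- Uses `r.choose j / (j + 1) = (r + 1).choose (j + 1) / (r + 1)` and the sum of a row of binomial
coefficients. -/
theorem average_inv_highCount (r : ℕ) :
    average (fun y : Fin r → Fin 2 => ((highCount y : ℝ) + 1)⁻¹) =
      2 * ((1 - (2 ^ (r + 1))⁻¹) / ((r : ℝ) + 1)) := by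
  rw [average_highCount r fun k => ((k : ℝ) + 1)⁻¹]
  have h : ∀ j ∈ Finset.range (r + 1), (r.choose j : ℝ) * ((j : ℝ) + 1)⁻¹ =
      ((r : ℝ) + 1)⁻¹ * ((r + 1).choose (j + 1) : ℝ) := by
    intro j _
    have := Nat.add_one_mul_choose_eq r j
    have h' : ((r : ℝ) + 1) * r.choose j = (r + 1).choose (j + 1) * ((j : ℝ) + 1) := by
      exact_mod_cast this
    field_simp
    linarith
  have h2 : ∑ j ∈ Finset.range (r + 1), ((r + 1).choose (j + 1) : ℝ) = 2 ^ (r + 1) - 1 := by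
    have := Nat.sum_range_choose (r + 1)
    rw [Finset.sum_range_succ'] at this
    have h' : (∑ j ∈ Finset.range (r + 1), ((r + 1).choose (j + 1) : ℝ)) + 1 = 2 ^ (r + 1) := by
      exact_mod_cast this
    linarith
  rw [Finset.sum_congr rfl h, ← Finset.mul_sum, h2]
  field_simp
  ring

/-- One more vertex is high with probability `1/2` and then adds `1 / (k + 1)`, where `k` counts the
other high vertices. -/
theorem average_harmonic_highCount (r : ℕ) :
    average (fun y : Fin r → Fin 2 => (harmonic (highCount y) : ℝ)) = binomialHarmonic r := by
  induction r with
  | zero => simp [average_of_isEmpty, highCount, binomialHarmonic]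
  | succ r ih =>
    have h0 : ∀ y : Fin r → Fin 2, highCount (Fin.cons 0 y : Fin (r + 1) → Fin 2) =
        highCount y := fun y => by simp [highCount, Fin.sum_univ_succ]
    have h1 : ∀ y : Fin r → Fin 2, highCount (Fin.cons 1 y : Fin (r + 1) → Fin 2) =
        highCount y + 1 := fun y => by simp [highCount, Fin.sum_univ_succ, add_comm]
    rw [average_succ]
    simp only [h0, h1, harmonic_succ, Rat.cast_add, Rat.cast_inv, Rat.cast_natCast, Nat.cast_add,
      Nat.cast_one, Rat.cast_one]
    rw [average_add, average_inv_highCount, ih, binomialHarmonic, binomialHarmonic,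
      Finset.sum_range_succ]
    ring

/-- The difference is minus a partial sum of `∑ 2 ^ (-i) / i = log 2`. -/
theorem tendsto_binomialHarmonic_sub :
    Tendsto (fun r => binomialHarmonic r - (harmonic r : ℝ)) atTop (𝓝 (-Real.log 2)) := by
  have h := Real.hasSum_pow_div_log_of_abs_lt_one (x := (1 / 2 : ℝ)) (by norm_num [abs_of_pos])
  have h2 := h.tendsto_sum_nat.neg
  rw [show Real.log (1 - 1 / 2) = - Real.log 2 by
    rw [show (1 : ℝ) - 1 / 2 = 2⁻¹ by norm_num, Real.log_inv], neg_neg] at h2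
  refine h2.congr fun r => ?_
  rw [binomialHarmonic, harmonic]
  push_cast
  rw [← Finset.sum_sub_distrib, ← Finset.sum_neg_distrib]
  refine Finset.sum_congr rfl fun j _ => ?_
  rw [one_div, inv_pow]
  field_simp
  ring

/-! ### The sundew -/

theorem highCount_update {r : ℕ} (y : Fin r → Fin 2) {j : Fin r} (hj : y j = 1) :
    highCount y = highCount (Function.update y j 0) + 1 := by
  classical
  have h1 : ∀ i, ((Function.update y j 0 i : Fin 2) : ℕ) =
      Function.update (fun i => (y i : ℕ)) j 0 i := fun i => by
    by_cases hi : i = j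
    · subst hi
      simp
    · simp [hi]
  rw [highCount, highCount, Finset.sum_congr rfl fun i _ => h1 i,
    Finset.sum_update_of_mem (Finset.mem_univ j), zero_add,
    ← Finset.sum_sdiff (Finset.subset_univ {j})]
  simp [hj]

section Sundew

variable {n r : ℕ}

theorem sundew_stepLow_pendant (h : r < n) (x : Fin (n - r) ⊕ Fin r → Fin 2) (j : Fin r) :
    (fun i => stepLow ((isCliqueTree_sundew h).pendant j) x (.inr i)) =
      Function.update (fun i => x (.inr i)) j (x (sundewAtt h j) ⊓ x (.inr j)) := by
  funext i
  by_cases hi : i = j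
  · subst hi
    rw [Function.update_self]
    exact stepLow_right _ x
  · rw [Function.update_of_ne hi]
    exact stepLow_of_ne _ x (by simp [sundewAtt]) (by simpa using hi)

theorem fin_two_cases (a : Fin 2) : a = 0 ∨ a = 1 := by omega

theorem harmonic_highCount_sub {y : Fin r → Fin 2} {j : Fin r} (hj : y j = 1) :
    (harmonic (highCount y) : ℝ) - harmonic (highCount (Function.update y j 0)) =
      (highCount y : ℝ)⁻¹ := by
  rw [highCount_update y hj, harmonic_succ]
  push_cast
  ring

theorem sundew_sum_sub (h : r < n) [Fintype (sundew n r).edgeSet] (x : Fin (n - r) ⊕ Fin r → Fin 2) :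
    ∑ e : (sundew n r).edgeSet, ((harmonic (highCount fun j => x (.inr j)) : ℝ) -
        harmonic (highCount fun j => stepLow e x (.inr j))) =
      ∑ j, if x (sundewAtt h j) = 0 ∧ x (.inr j) = 1 then
        ((highCount fun j => x (.inr j) : ℕ) : ℝ)⁻¹ else 0 := by
  rw [(isCliqueTree_sundew h).sum_edgeSet, Finset.sum_eq_zero, zero_add]
  · refine Finset.sum_congr rfl fun j _ => ?_
    rw [sundew_stepLow_pendant]
    rcases fin_two_cases (x (.inr j)) with hj | hj
    · have : Function.update (fun i => x (.inr i)) j (x (sundewAtt h j) ⊓ x (.inr j)) =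
          fun i => x (.inr i) := by
        rw [hj]
        exact Function.update_eq_self_iff.2 (by simp [hj])
      rw [this, if_neg (by simp [hj]), sub_self]
    · rcases fin_two_cases (x (sundewAtt h j)) with ha | ha
      · rw [if_pos ⟨ha, hj⟩, ha, show (0 : Fin 2) ⊓ x (.inr j) = 0 by simp]
        exact harmonic_highCount_sub (y := fun j => x (.inr j)) hj
      · have : Function.update (fun i => x (.inr i)) j (x (sundewAtt h j) ⊓ x (.inr j)) =
            fun i => x (.inr i) :=
          Function.update_eq_self_iff.2 (by simp [hj, ha])
        rw [this, if_neg (by simp [ha]), sub_self]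
  · intro e _
    rw [sub_eq_zero]
    congr! 4
    exact ((isCliqueTree_sundew h).stepLow_clique_inr e x _).symm

theorem sum_inv_highCount (y : Fin r → Fin 2) (hy : ∃ j, y j = 1) :
    ∑ j, (if y j = 1 then (highCount y : ℝ)⁻¹ else 0) = 1 := by
  have h1 : ∀ j, (if y j = 1 then (highCount y : ℝ)⁻¹ else 0) =
      ((y j : ℕ) : ℝ) * (highCount y : ℝ)⁻¹ := fun j => by
    rcases fin_two_cases (y j) with hj | hj <;> simp [hj]
  have h2 : highCount y ≠ 0 := by
    obtain ⟨j, hj⟩ := hy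
    rw [highCount_update y hj]
    exact Nat.succ_ne_zero _
  rw [Finset.sum_congr rfl fun j _ => h1 j, ← Finset.sum_mul, ← Nat.cast_sum]
  exact mul_inv_cancel₀ (by exact_mod_cast h2)

theorem harmonic_nonneg (k : ℕ) : (0 : ℝ) ≤ harmonic k := by
  rw [harmonic]
  push_cast
  positivity

theorem harmonic_mono : Monotone fun k : ℕ => (harmonic k : ℝ) := by
  refine monotone_nat_of_le_succ fun k => ?_
  rw [harmonic_succ]
  push_cast
  have : (0 : ℝ) ≤ ((k : ℝ) + 1)⁻¹ := by positivity
  linarith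

theorem highCount_mono {y z : Fin r → Fin 2} (hyz : y ≤ z) : highCount y ≤ highCount z :=
  Finset.sum_le_sum fun j _ => hyz j

/-- Next to an all-low clique, each of the `k` high pendant vertices has one edge that lowers it and
reduces the harmonic potential by `1 / k`. -/
theorem expectedTimeZero_sundew_le (h : r < n) :
    expectedTimeZero (sundew n r) ≤ ENNReal.ofReal (numEdges (sundew n r) *
      (binomialHarmonic r + (fillTime (n - r) 1 + (2 ^ (n - r))⁻¹ * 2))) := by
  classical
  have hG := isCliqueTree_sundew h
  refine (expectedTimeZero_le_clique (G := sundew n r)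
    -- Any nonnegative constant `d` would do, since a low pendant vertex infects the clique in one
    -- interaction; `1` yields the same error term as for the lollipop.
    (B := fun x => harmonic (highCount fun j => x (.inr j))) (d := fun _ => 1)
    (fun a b => (hG.adj_inl a b).2) (fun x => harmonic_nonneg _)
    (fun e x => harmonic_mono (highCount_mono fun j => stepLow_le e x _))
    (fun _ => zero_le_one) (fun _ _ => le_rfl) ?_ ?_).trans ?_
  · intro x hx h0
    rw [sundew_sum_sub h]
    have h1 : ∀ j, x (sundewAtt h j) = 0 := fun j => h0 _
    simp only [h1, true_and]
    refine (sum_inv_highCount (fun j => x (.inr j)) ?_).ge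
    by_contra! hall
    refine hx ?_
    have : ∀ v, x v = 0 := by
      rintro (a | j)
      · exact h0 a
      · exact (fin_two_cases _).resolve_right (hall j)
    intro u v
    rw [this, this]
  · intro x hx h1
    obtain ⟨j, hj⟩ : ∃ j, x (.inr j) = 0 := by
      by_contra! hall
      refine hx ?_
      have : ∀ v, x v = 1 := by
        rintro (a | j)
        · exact h1 a
        · exact eq_one_of_ne_zero (hall j)
      intro u v
      rw [this, this]
    refine ⟨hG.pendant j, Or.inl ⟨⟨(j : ℕ) % (n - r), Nat.mod_lt _ (Nat.sub_pos_of_lt h)⟩, ?_⟩⟩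
    refine (stepLow_left _ x).trans ?_
    rw [hj]
    simp
  · refine ENNReal.ofReal_le_ofReal (mul_le_mul_of_nonneg_left ?_ (Nat.cast_nonneg _))
    rw [average_add, average_inr (fun y => (harmonic (highCount y) : ℝ)),
      average_harmonic_highCount]
    have := average_cliquePart_le (m := n - r) (r := r) (d := fun _ => 1) fun _ => zero_le_one
    rw [average_const] at this
    norm_num at this ⊢
    linarith

/-- The coupon-collector potential loses at most one in total whatever the clique looks like. It has
to be cut to zero at the all-high consensus, which costs at most `2 ^ (-r) * h(r)` on average. -/
theorem le_expectedTimeZero_sundew (h : r < n) :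
    ENNReal.ofReal (numEdges (sundew n r) * (binomialHarmonic r - (2 ^ r)⁻¹ * harmonic r)) ≤
      expectedTimeZero (sundew n r) := by
  classical
  have hG := isCliqueTree_sundew h
  set B : (Fin (n - r) ⊕ Fin r → Fin 2) → ℝ :=
    fun x => harmonic (highCount fun j => x (.inr j)) with hB
  set φ : (Fin (n - r) ⊕ Fin r → Fin 2) → ℝ := fun x => if IsConsensus x then 0 else B x with hφ
  have hφ0 : ∀ x, 0 ≤ φ x := fun x => by
    simp only [hφ]
    split_ifs
    · exact le_rfl
    · exact harmonic_nonneg _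
  have hzero : ∀ x v, IsConsensus x → x v = 0 → B x = 0 := by
    intro x v hx hv
    have : (highCount fun j => x (.inr j)) = 0 :=
      Finset.sum_eq_zero fun j _ => by
        show ((x (.inr j) : Fin 2) : ℕ) = 0
        rw [hx (.inr j) v, hv]
        rfl
    simp [hB, this]
  refine le_trans ?_ (le_expectedTimeZero (sundew n r) hφ0 (fun x hx => if_pos hx) ?_
    (ne_top_of_le_ne_top ENNReal.ofReal_ne_top (expectedTimeZero_sundew_le h)))
  · refine ENNReal.ofReal_le_ofReal (mul_le_mul_of_nonneg_left ?_ (Nat.cast_nonneg _))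
    have h1 : ∀ x, B x ≤ φ x + (if ∀ a, x a = 1 then (1 : ℝ) else 0) * harmonic r := by
      intro x
      have hr := harmonic_nonneg r
      simp only [hφ]
      split_ifs with hx hx' hx'
      · have : (highCount fun j => x (.inr j)) = r := by simp [highCount, hx']
        simp [hB, this]
      · have : ∃ a, x a = 0 := by
          push Not at hx'
          obtain ⟨a, ha⟩ := hx'
          exact ⟨a, (fin_two_cases _).resolve_right ha⟩
        obtain ⟨a, ha⟩ := this
        simp [hzero x a hx ha]
      · linarith
      · linarith
    have h2 := average_mono h1
    rw [average_inr (fun y => (harmonic (highCount y) : ℝ)), average_harmonic_highCount,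
      average_add] at h2
    have h3 : average (fun x : Fin (n - r) ⊕ Fin r → Fin 2 =>
        (if ∀ a, x a = 1 then (1 : ℝ) else 0) * (harmonic r : ℝ)) =
        (2 ^ Fintype.card (Fin (n - r) ⊕ Fin r))⁻¹ * (harmonic r : ℝ) := by
      rw [← average_eq_one (Fin (n - r) ⊕ Fin r)]
      simp only [average, ← Finset.sum_mul, mul_assoc]
    have h4 : ((2 : ℝ) ^ Fintype.card (Fin (n - r) ⊕ Fin r))⁻¹ ≤ (2 ^ r)⁻¹ := by
      rw [Fintype.card_sum, Fintype.card_fin, Fintype.card_fin]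
      gcongr
      · norm_num
      · omega
    have h5 := mul_le_mul_of_nonneg_right h4 (harmonic_nonneg r)
    linarith
  · intro x hx
    have h1 : ∀ e : (sundew n r).edgeSet, φ x - φ (stepLow e x) = B x - B (stepLow e x) := by
      intro e
      have h2 : φ x = B x := if_neg hx
      rw [h2]
      -- A discordant configuration has a low vertex, which stays low; so only the low consensus can
      -- be reached, and there `B` vanishes as well.
      by_cases hs : IsConsensus (stepLow e x)
      · obtain ⟨v, hv⟩ : ∃ v, x v = 0 := by
          by_contra! hall
          exact hx fun u v => by
            rw [eq_one_of_ne_zero (hall u), eq_one_of_ne_zero (hall v)]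
        rw [hzero _ v hs (stepLow_eq_zero e hv), show φ (stepLow e x) = 0 from if_pos hs]
      · rw [show φ (stepLow e x) = B (stepLow e x) from if_neg hs]
    rw [Finset.sum_congr rfl fun e _ => h1 e, sundew_sum_sub h]
    by_cases hy : ∃ j, x (.inr j) = 1
    · rw [← sum_inv_highCount (fun j => x (.inr j)) hy]
      refine Finset.sum_le_sum fun j _ => ?_
      split_ifs with ha hb hb
      · exact le_rfl
      · exact absurd ha.2 hb
      · positivity
      · exact le_rfl
    · push Not at hy
      rw [Finset.sum_eq_zero fun j _ => if_neg fun ha => hy j ha.2]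
      exact zero_le_one

end Sundew

/-! ### Gaps of a path -/

/-- The product, over the maximal runs of high vertices of the path `y`, of `F` of the length of
the run, with `E` in place of `F` for the final run; the first run is preceded by `l` further high
vertices. -/
def gapProd (F E : ℕ → ℝ) : ℕ → List (Fin 2) → ℝ
  | l, [] => E l
  | l, a :: y => if a = 0 then F l * gapProd F E 0 y else gapProd F E (l + 1) y

/-- The path after an interaction along its edge `j`; the edge `0` comes from a low vertex. -/
def pathStep : ℕ → List (Fin 2) → List (Fin 2)
  | _, [] => []
  | 0, _ :: y => 0 :: y
  | 1, [a] => [a]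
  | 1, a :: b :: y => (a ⊓ b) :: (a ⊓ b) :: y
  | j + 2, a :: y => a :: pathStep (j + 1) y

/-- The value of `gapProd` after an interaction along the edge `j`, where the path is preceded by
`l` high vertices, or by a low one if `l = 0`. -/
def gapStep (F E : ℕ → ℝ) : ℕ → List (Fin 2) → ℕ → ℝ
  | l, [], _ => E l
  | l, a :: y, 0 => if a = 0 then gapProd F E (l - 1) (a :: y) else
      if l = 0 then gapProd F E 0 (0 :: y) else gapProd F E l (a :: y)
  | l, a :: y, j + 1 => if a = 0 then F l * gapStep F E 0 y j else gapStep F E (l + 1) y j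

/-- The backward equation. An inner gap shrinks at both ends, whence the factor `2`, and the final
one at a single end. The sum runs over the edges into the vertices of `y`; the additional difference
with `l - 1` is the shrinking at the far left end of the `l` preceding high vertices. -/
theorem hasDerivAt_gapProd {F E : ℝ → ℕ → ℝ} {t : ℝ}
    (hF : ∀ l, HasDerivAt (fun s => F s l) (2 * (F t (l - 1) - F t l)) t)
    (hE : ∀ l, HasDerivAt (fun s => E s l) (E t (l - 1) - E t l) t) (hF0 : F t 0 = 1) (l : ℕ)
    (y : List (Fin 2)) :
    HasDerivAt (fun s => gapProd (F s) (E s) l y)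
      (gapProd (F t) (E t) (l - 1) y - gapProd (F t) (E t) l y +
        ∑ j ∈ Finset.range y.length, (gapStep (F t) (E t) l y j - gapProd (F t) (E t) l y)) t := by
  induction y generalizing l with
  | nil => simpa [gapProd] using hE l
  | cons a y ih =>
    simp only [List.length_cons, Finset.sum_range_succ']
    by_cases ha : a = 0
    · simp only [gapProd, gapStep, ha, if_true]
      refine ((hF l).mul (ih 0)).congr_deriv ?_
      simp only [← mul_sub, ← Finset.mul_sum]
      simp only [Nat.zero_sub]
      ring
    · simp only [gapProd, gapStep, ha, if_false, if_true]
      refine (ih (l + 1)).congr_deriv ?_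
      rcases l with _ | l
      · simp only [Nat.zero_sub, zero_add, if_true, Nat.sub_self, hF0]
        ring
      · simp only [Nat.add_sub_cancel, if_neg (Nat.succ_ne_zero l)]
        ring

/-- The edge `0` is excluded for `l ≠ 0`: it may lower one of the preceding high vertices, whereas
`pathStep` takes the preceding vertex to be low. -/
theorem gapStep_eq {F E : ℕ → ℝ} (hF0 : F 0 = 1) (y : List (Fin 2)) (l j : ℕ) (hj : j < y.length)
    (hjl : j ≠ 0 ∨ l = 0) : gapStep F E l y j = gapProd F E l (pathStep j y) := by
  induction y generalizing l j with
  | nil => simp at hj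
  | cons a y ih =>
    rcases j with _ | _ | j
    · obtain rfl : l = 0 := by simpa using hjl
      by_cases ha : a = 0 <;> simp [gapStep, pathStep, gapProd, ha]
    · rcases y with _ | ⟨b, z⟩
      · simp at hj
      · rcases fin_two_cases a with rfl | rfl <;> rcases fin_two_cases b with rfl | rfl <;>
          simp [gapStep, pathStep, gapProd, hF0]
    · have h1 := fun l => ih l (j + 1) (by simpa using hj) (Or.inl (Nat.succ_ne_zero j))
      by_cases ha : a = 0 <;> simp [gapStep, pathStep, gapProd, ha, h1]

section Monotone

variable {F E : ℕ → ℝ}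

theorem gapProd_nonneg (hF0 : ∀ l, 0 ≤ F l) (hE0 : ∀ l, 0 ≤ E l) (l : ℕ) (y : List (Fin 2)) :
    0 ≤ gapProd F E l y := by
  induction y generalizing l with
  | nil => exact hE0 l
  | cons a y ih =>
    rw [gapProd]
    split_ifs
    · exact mul_nonneg (hF0 l) (ih 0)
    · exact ih _

theorem gapProd_antitone (hF : Antitone F) (hE : Antitone E) (hF0 : ∀ l, 0 ≤ F l)
    (hE0 : ∀ l, 0 ≤ E l) (y : List (Fin 2)) : Antitone fun l => gapProd F E l y := by
  induction y with
  | nil => exact hE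
  | cons a y ih =>
    intro k l hkl
    simp only [gapProd]
    split_ifs
    · exact mul_le_mul_of_nonneg_right (hF hkl) (gapProd_nonneg hF0 hE0 0 y)
    · exact ih (Nat.succ_le_succ hkl)

/-- An interaction shortens at most one gap, by one vertex, and the factors decrease in the length.
-/
theorem gapProd_le_gapStep (hF : Antitone F) (hE : Antitone E) (hF0 : ∀ l, 0 ≤ F l)
    (hE0 : ∀ l, 0 ≤ E l) (hF1 : F 0 = 1) (y : List (Fin 2)) (l j : ℕ) :
    gapProd F E l y ≤ gapStep F E l y j := by
  induction y generalizing l j with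
  | nil => simp [gapProd, gapStep]
  | cons a y ih =>
    rcases j with _ | j
    · by_cases ha : a = 0
      · rw [gapStep, if_pos ha]
        exact gapProd_antitone hF hE hF0 hE0 (a :: y) (Nat.sub_le l 1)
      · by_cases hl : l = 0
        · subst hl
          simp only [gapStep, ha, if_false, if_true, gapProd, hF1, one_mul]
          exact gapProd_antitone hF hE hF0 hE0 y (Nat.zero_le _)
        · rw [gapStep, if_neg ha, if_neg hl]
    · by_cases ha : a = 0
      · simp only [gapStep, gapProd, ha, if_true]
        exact mul_le_mul_of_nonneg_left (ih 0 j) (hF0 l)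
      · simp only [gapStep, gapProd, ha, if_false]
        exact ih _ j

theorem gapProd_le_one (hF0 : ∀ l, 0 ≤ F l) (hE0 : ∀ l, 0 ≤ E l) (hF1 : ∀ l, F l ≤ 1)
    (hE1 : ∀ l, E l ≤ 1) (l : ℕ) (y : List (Fin 2)) : gapProd F E l y ≤ 1 := by
  induction y generalizing l with
  | nil => exact hE1 l
  | cons a y ih =>
    rw [gapProd]
    split_ifs
    · exact mul_le_one₀ (hF1 l) (gapProd_nonneg hF0 hE0 0 y) (ih 0)
    · exact ih _

end Monotone

/-! ### Averages of gap products -/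

/-- The average of `gapProd` over the paths with `r` vertices. -/
def avgGap (F E : ℕ → ℝ) : ℕ → ℕ → ℝ
  | 0, l => E l
  | r + 1, l => (F l * avgGap F E r 0 + avgGap F E r (l + 1)) / 2

theorem average_const_mul {ι : Type*} [Fintype ι] (c : ℝ) (f : ι → ℝ) :
    average (fun x => c * f x) = c * average f := by
  simp only [average, ← Finset.mul_sum]
  ring

theorem average_gapProd (F E : ℕ → ℝ) (r l : ℕ) :
    average (fun y : Fin r → Fin 2 => gapProd F E l (List.ofFn y)) = avgGap F E r l := by
  induction r generalizing l with
  | zero => simp [average_of_isEmpty, gapProd, avgGap]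
  | succ r ih =>
    rw [average_succ]
    simp only [List.ofFn_cons, gapProd, if_true, one_ne_zero, if_false]
    rw [average_const_mul, ih, ih, avgGap]

theorem avgGap_nonneg {F E : ℕ → ℝ} (hF0 : ∀ l, 0 ≤ F l) (hE0 : ∀ l, 0 ≤ E l) (r l : ℕ) :
    0 ≤ avgGap F E r l := by
  rw [← average_gapProd, average]
  exact mul_nonneg (by positivity) (Finset.sum_nonneg fun y _ => gapProd_nonneg hF0 hE0 _ _)

theorem avgGap_le_one {F E : ℕ → ℝ} (hF0 : ∀ l, 0 ≤ F l) (hE0 : ∀ l, 0 ≤ E l)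
    (hF1 : ∀ l, F l ≤ 1) (hE1 : ∀ l, E l ≤ 1) (r l : ℕ) : avgGap F E r l ≤ 1 := by
  rw [← average_gapProd, ← average_const (ι := Fin r → Fin 2) 1]
  exact average_mono fun y => gapProd_le_one hF0 hE0 hF1 hE1 _ _

/-- The expectation of `F` over `M` independent geometric run lengths, the first of them given to
be at least `l`. -/
def geomGap (G : ℕ → ℝ) : ℕ → ℕ → ℝ
  | 0, _ => 1
  | M + 1, l => G l * G 0 ^ M

section Geometric

variable {F G : ℕ → ℝ}

theorem geomGap_zero (M : ℕ) : geomGap G M 0 = G 0 ^ M := by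
  cases M with
  | zero => simp [geomGap]
  | succ M => rw [geomGap, pow_succ, mul_comm]

/-- The recursion of `avgGap`, except that a low vertex also uses up one of the `M` runs. -/
theorem geomGap_succ (hG : ∀ l, G l = (F l + G (l + 1)) / 2) (M l : ℕ) :
    geomGap G (M + 1) l = (F l * geomGap G M 0 + geomGap G (M + 1) (l + 1)) / 2 := by
  rw [geomGap_zero, geomGap, geomGap, hG l]
  ring

theorem geomGap_nonneg (hG0 : ∀ l, 0 ≤ G l) (M l : ℕ) : 0 ≤ geomGap G M l := by
  cases M with
  | zero => exact zero_le_one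
  | succ M => exact mul_nonneg (hG0 l) (pow_nonneg (hG0 0) M)

theorem geomGap_le_one (hG0 : ∀ l, 0 ≤ G l) (hG1 : ∀ l, G l ≤ 1) (M l : ℕ) :
    geomGap G M l ≤ 1 := by
  cases M with
  | zero => exact le_rfl
  | succ M => exact mul_le_one₀ (hG1 l) (pow_nonneg (hG0 0) M) (pow_le_one₀ (hG0 0) (hG1 0))

/-- With at least `M` low vertices, the first `M` runs are independent and geometric, and further
factors are at most one. The error is Chebyshev's bound for fewer than `M` low vertices: the mean of
`((X - M - δ) / δ) ^ 2` for the binomial number `X` of low vertices. This mean satisfies the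
recursion exactly, so induction on `r` applies without probability theory. -/
theorem avgGap_le (hF0 : ∀ l, 0 ≤ F l) (hF1 : ∀ l, F l ≤ 1) (hG0 : ∀ l, 0 ≤ G l)
    (hG : ∀ l, G l = (F l + G (l + 1)) / 2) {δ : ℝ} (hδ : 0 < δ) (r M l : ℕ) :
    avgGap F (fun _ => 1) r l ≤
      geomGap G M l + ((r : ℝ) / 4 + ((r : ℝ) / 2 - M - δ) ^ 2) / δ ^ 2 := by
  have h1 : ∀ (r : ℕ) (M : ℕ), (0 : ℝ) ≤ ((r : ℝ) / 4 + ((r : ℝ) / 2 - M - δ) ^ 2) / δ ^ 2 :=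
    fun r M => by positivity
  induction r generalizing M l with
  | zero =>
    rcases M with _ | M
    · have := h1 0 0
      simp only [avgGap, geomGap]
      linarith
    · have h2 := geomGap_nonneg hG0 (M + 1) l
      have h3 : (1 : ℝ) ≤ (((0 : ℕ) : ℝ) / 4 + (((0 : ℕ) : ℝ) / 2 - (M + 1 : ℕ) - δ) ^ 2) / δ ^ 2 := by
        rw [le_div_iff₀ (by positivity)]
        have : (0 : ℝ) ≤ (M : ℝ) := Nat.cast_nonneg M
        push_cast
        nlinarith
      simp only [avgGap]
      linarith
  | succ r ih =>
    rcases M with _ | M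
    · have h2 := avgGap_le_one hF0 (fun _ => zero_le_one) hF1 (fun _ => le_rfl) (r + 1) l
      have := h1 (r + 1) 0
      rw [geomGap]
      linarith
    · rw [geomGap_succ hG, avgGap]
      have h2 := mul_le_mul_of_nonneg_left (ih M 0) (hF0 l)
      have h3 := ih (M + 1) (l + 1)
      have h4 := mul_le_mul_of_nonneg_right (hF1 l) (h1 r M)
      have h5 : ((r : ℝ) / 4 + ((r : ℝ) / 2 - M - δ) ^ 2) / δ ^ 2 +
          ((r : ℝ) / 4 + ((r : ℝ) / 2 - (M + 1 : ℕ) - δ) ^ 2) / δ ^ 2 =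
          2 * ((((r + 1 : ℕ) : ℝ) / 4 + (((r + 1 : ℕ) : ℝ) / 2 - (M + 1 : ℕ) - δ) ^ 2) / δ ^ 2) := by
        push_cast
        ring
      linarith

/-- The mirror image: fewer than `M` low vertices leave at most `M` factors, and the mean of `((X -
M + δ) / δ) ^ 2` bounds the probability of the opposite event. -/
theorem le_avgGap (hF0 : ∀ l, 0 ≤ F l) (hF1 : ∀ l, F l ≤ 1) (hG0 : ∀ l, 0 ≤ G l)
    (hG1 : ∀ l, G l ≤ 1) (hG : ∀ l, G l = (F l + G (l + 1)) / 2) {δ : ℝ} (hδ : 0 < δ)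
    (r M l : ℕ) : geomGap G M l - ((r : ℝ) / 4 + ((r : ℝ) / 2 - M + δ) ^ 2) / δ ^ 2 ≤
      avgGap F (fun _ => 1) r l := by
  have h1 : ∀ (r : ℕ) (M : ℕ), (0 : ℝ) ≤ ((r : ℝ) / 4 + ((r : ℝ) / 2 - M + δ) ^ 2) / δ ^ 2 :=
    fun r M => by positivity
  induction r generalizing M l with
  | zero =>
    have h2 := geomGap_le_one hG0 hG1 M l
    have h3 := h1 0 M
    simp only [avgGap]
    linarith
  | succ r ih =>
    rcases M with _ | M
    · have h2 := avgGap_nonneg hF0 (fun _ => zero_le_one) (E := fun _ => 1) (r + 1) l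
      have h3 : (1 : ℝ) ≤ (((r + 1 : ℕ) : ℝ) / 4 +
          (((r + 1 : ℕ) : ℝ) / 2 - (0 : ℕ) + δ) ^ 2) / δ ^ 2 := by
        rw [le_div_iff₀ (by positivity)]
        have : (0 : ℝ) ≤ (r : ℝ) := Nat.cast_nonneg r
        push_cast
        nlinarith
      rw [geomGap]
      linarith
    · rw [geomGap_succ hG, avgGap]
      have h2 := mul_le_mul_of_nonneg_left (ih M 0) (hF0 l)
      have h3 := ih (M + 1) (l + 1)
      have h4 := mul_le_mul_of_nonneg_right (hF1 l) (h1 r M)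
      have h5 : ((r : ℝ) / 4 + ((r : ℝ) / 2 - M + δ) ^ 2) / δ ^ 2 +
          ((r : ℝ) / 4 + ((r : ℝ) / 2 - (M + 1 : ℕ) + δ) ^ 2) / δ ^ 2 =
          2 * ((((r + 1 : ℕ) : ℝ) / 4 + (((r + 1 : ℕ) : ℝ) / 2 - (M + 1 : ℕ) + δ) ^ 2) / δ ^ 2) := by
        push_cast
        ring
      linarith

/-- There are at most `r` low vertices, so no error term is needed for `M > r`. -/
theorem geomGap_le_avgGap (hF0 : ∀ l, 0 ≤ F l) (hG0 : ∀ l, 0 ≤ G l) (hG1 : ∀ l, G l ≤ 1)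
    (hG : ∀ l, G l = (F l + G (l + 1)) / 2) {r M : ℕ} (hM : r < M) (l : ℕ) :
    geomGap G M l ≤ avgGap F (fun _ => 1) r l := by
  induction r generalizing M l with
  | zero => exact geomGap_le_one hG0 hG1 M l
  | succ r ih =>
    obtain ⟨M, rfl⟩ := Nat.exists_eq_add_one_of_ne_zero (Nat.ne_of_gt (Nat.zero_lt_of_lt hM))
    rw [geomGap_succ hG, avgGap]
    have h2 := mul_le_mul_of_nonneg_left (ih (Nat.lt_of_succ_lt_succ hM) 0) (hF0 l)
    have h3 := ih (Nat.lt_of_succ_lt hM) (l + 1)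
    linarith

/-- The bracket is the exact mean of `(4 / 3) ^ L` for the length `L` of the final run. It stays
bounded in `r` because `4 / 3 < 2`. -/
theorem avgGap_sub_le {E : ℕ → ℝ} (hF0 : ∀ l, 0 ≤ F l) (hF1 : ∀ l, F l ≤ 1) {η : ℝ}
    (hη : 0 ≤ η) (hE : ∀ l, 1 - E l ≤ (4 / 3) ^ l * η) (r l : ℕ) :
    avgGap F (fun _ => 1) r l - avgGap F E r l ≤
      (3 / 2 * (1 - (2 / 3) ^ r) + (2 / 3) ^ r * (4 / 3) ^ l) * η := by
  have h1 : ∀ (r l : ℕ), 0 ≤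
      (3 / 2 * (1 - (2 / 3) ^ r) + (2 / 3) ^ r * (4 / 3) ^ l) * η := fun r l => by
    have : ((2 : ℝ) / 3) ^ r ≤ 1 := pow_le_one₀ (by norm_num) (by norm_num)
    have : (0 : ℝ) ≤ 1 - (2 / 3) ^ r := by linarith
    positivity
  induction r generalizing l with
  | zero => simpa [avgGap] using hE l
  | succ r ih =>
    rw [avgGap, avgGap]
    have h2 := mul_le_mul_of_nonneg_left (ih 0) (hF0 l)
    have h3 := ih (l + 1)
    have h4 := mul_le_mul_of_nonneg_right (hF1 l) (h1 r 0)
    have h5 : (3 / 2 * (1 - (2 / 3) ^ r) + (2 / 3) ^ r * (4 / 3) ^ 0) * η +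
        (3 / 2 * (1 - (2 / 3) ^ r) + (2 / 3) ^ r * (4 / 3) ^ (l + 1)) * η =
        2 * ((3 / 2 * (1 - (2 / 3) ^ (r + 1)) + (2 / 3) ^ (r + 1) * (4 / 3) ^ l) * η) := by
      ring
    linarith

theorem avgGap_zero_sub_le {E : ℕ → ℝ} (hF0 : ∀ l, 0 ≤ F l) (hF1 : ∀ l, F l ≤ 1) {η : ℝ}
    (hη : 0 ≤ η) (hE : ∀ l, 1 - E l ≤ (4 / 3) ^ l * η) (r : ℕ) :
    avgGap F (fun _ => 1) r 0 - avgGap F E r 0 ≤ 3 / 2 * η := by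
  refine (avgGap_sub_le hF0 hF1 hη hE r 0).trans (mul_le_mul_of_nonneg_right ?_ hη)
  have : (0 : ℝ) ≤ (2 / 3) ^ r := by positivity
  linarith

end Geometric

/-! ### The number of leading high vertices -/

/-- The number of high vertices before the first low one. -/
def leadHigh : List (Fin 2) → ℕ
  | [] => 0
  | a :: y => if a = 0 then 0 else leadHigh y + 1

theorem average_leadHigh_le (r : ℕ) :
    average (fun y : Fin r → Fin 2 => (leadHigh (List.ofFn y) : ℝ)) ≤ 1 := by
  induction r with
  | zero => simp [average_of_isEmpty, leadHigh]
  | succ r ih =>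
    rw [average_succ]
    simp only [List.ofFn_cons, leadHigh, if_true, one_ne_zero, if_false, Nat.cast_add,
      Nat.cast_one, Nat.cast_zero]
    rw [average_const, average_add, average_const]
    linarith

/-! ### Erlang distributions -/

/-- The distribution function of the sum of `l` independent exponential variables of rate one. -/
def erlang (l : ℕ) (s : ℝ) : ℝ :=
  1 - Real.exp (-s) * ∑ j ∈ Finset.range l, s ^ j / (j.factorial : ℝ)

theorem erlang_zero_left (s : ℝ) : erlang 0 s = 1 := by simp [erlang]

theorem erlang_zero_right {l : ℕ} (hl : l ≠ 0) : erlang l 0 = 0 := by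
  obtain ⟨l, rfl⟩ := Nat.exists_eq_succ_of_ne_zero hl
  simp [erlang, Finset.sum_range_succ']

theorem erlang_succ (l : ℕ) (s : ℝ) :
    erlang (l + 1) s = erlang l s - Real.exp (-s) * (s ^ l / (l.factorial : ℝ)) := by
  rw [erlang, erlang, Finset.sum_range_succ]
  ring

theorem hasDerivAt_erlang (l : ℕ) (s : ℝ) :
    HasDerivAt (erlang l) (erlang (l - 1) s - erlang l s) s := by
  have hexp : HasDerivAt (fun s : ℝ => Real.exp (-s)) (-Real.exp (-s)) s := by
    simpa using (hasDerivAt_neg s).exp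
  induction l with
  | zero =>
    have : erlang 0 = fun _ => 1 := funext erlang_zero_left
    simpa [this] using hasDerivAt_const s (1 : ℝ)
  | succ l ih =>
    have h1 : erlang (l + 1) = fun s => erlang l s - Real.exp (-s) * (s ^ l / (l.factorial : ℝ)) :=
      funext (erlang_succ l)
    rw [h1]
    refine (ih.sub (hexp.mul ((hasDerivAt_pow l s).div_const _))).congr_deriv ?_
    rcases l with _ | l
    · simp
    · simp only [Nat.add_sub_cancel, erlang_succ, Nat.factorial_succ]
      push_cast
      field_simp
      ring

theorem erlang_antitone {s : ℝ} (hs : 0 ≤ s) : Antitone fun l => erlang l s := by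
  refine antitone_nat_of_succ_le fun l => ?_
  rw [erlang_succ]
  have : 0 ≤ Real.exp (-s) * (s ^ l / (l.factorial : ℝ)) := by positivity
  linarith

theorem erlang_nonneg {s : ℝ} (hs : 0 ≤ s) (l : ℕ) : 0 ≤ erlang l s := by
  have h := mul_le_mul_of_nonneg_left (Real.sum_le_exp_of_nonneg hs l) (Real.exp_pos (-s)).le
  rw [← Real.exp_add, neg_add_cancel, Real.exp_zero] at h
  exact sub_nonneg.2 h

theorem erlang_le_one {s : ℝ} (hs : 0 ≤ s) (l : ℕ) : erlang l s ≤ 1 :=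
  (erlang_antitone hs (Nat.zero_le l)).trans_eq (erlang_zero_left s)

/-- A Chernoff bound from `s ^ j = (4 / 3) ^ j * (3 / 4 * s) ^ j`. The base `4 / 3` is below `2`, so
the bound is integrable against geometric lengths. -/
theorem one_sub_erlang_le {s : ℝ} (hs : 0 ≤ s) (l : ℕ) :
    1 - erlang l s ≤ (4 / 3) ^ l * Real.exp (-(s / 4)) := by
  have h1 : ∑ j ∈ Finset.range l, s ^ j / (j.factorial : ℝ) ≤
      (4 / 3) ^ l * Real.exp (3 / 4 * s) := by
    refine le_trans ?_ (mul_le_mul_of_nonneg_left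
      (Real.sum_le_exp_of_nonneg (x := 3 / 4 * s) (by positivity) l) (by positivity))
    rw [Finset.mul_sum]
    refine Finset.sum_le_sum fun j hj => ?_
    have h2 : ((4 : ℝ) / 3) ^ j ≤ (4 / 3) ^ l :=
      pow_le_pow_right₀ (by norm_num) (Finset.mem_range.1 hj).le
    calc s ^ j / (j.factorial : ℝ) = (4 / 3) ^ j * ((3 / 4 * s) ^ j / (j.factorial : ℝ)) := by
          rw [← mul_div_assoc, ← mul_pow]
          ring
      _ ≤ _ := mul_le_mul_of_nonneg_right h2 (by positivity)
  calc 1 - erlang l s = Real.exp (-s) * ∑ j ∈ Finset.range l, s ^ j / (j.factorial : ℝ) := by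
        rw [erlang]
        ring
    _ ≤ Real.exp (-s) * ((4 / 3) ^ l * Real.exp (3 / 4 * s)) :=
        mul_le_mul_of_nonneg_left h1 (Real.exp_pos _).le
    _ = (4 / 3) ^ l * Real.exp (-(s / 4)) := by
        rw [mul_left_comm, ← Real.exp_add]
        ring_nf

/-- Term by term, `2 ^ l ≤ 2 ^ (j + l)`. This serves the nonnegativity of `geomErlang`. -/
theorem exp_tail_scale {s : ℝ} (hs : 0 ≤ s) (l : ℕ) :
    2 ^ l * (Real.exp s - ∑ j ∈ Finset.range l, s ^ j / (j.factorial : ℝ)) ≤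
      Real.exp (2 * s) - ∑ j ∈ Finset.range l, (2 * s) ^ j / (j.factorial : ℝ) := by
  have key : ∀ x : ℝ, Real.exp x - ∑ j ∈ Finset.range l, x ^ j / (j.factorial : ℝ) =
      ∑' j : ℕ, x ^ (j + l) / ((j + l).factorial : ℝ) := by
    intro x
    have h := NormedSpace.expSeries_div_hasSum_exp (𝔸 := ℝ) x
    rw [Real.exp_eq_exp_ℝ, ← h.tsum_eq, ← h.summable.sum_add_tsum_nat_add l]
    ring
  have hsum : ∀ x : ℝ, Summable fun j : ℕ => x ^ (j + l) / ((j + l).factorial : ℝ) := fun x =>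
    (summable_nat_add_iff l).2 (NormedSpace.expSeries_div_hasSum_exp (𝔸 := ℝ) x).summable
  rw [key, key, ← tsum_mul_left]
  refine ((hsum s).mul_left _).tsum_le_tsum (fun j => ?_) (hsum (2 * s))
  rw [← mul_div_assoc, mul_pow]
  have h2 : (2 : ℝ) ^ l ≤ 2 ^ (j + l) := pow_le_pow_right₀ (by norm_num) (Nat.le_add_left l j)
  gcongr

/-- The mean of `erlang k (2 * t)` for a geometric variable `k`, given that it is at least `l`. -/
def geomErlang (t : ℝ) (l : ℕ) : ℝ :=
  erlang l (2 * t) - 2 ^ l / 2 * (Real.exp (-(2 * t)) *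
    (Real.exp t - ∑ j ∈ Finset.range l, t ^ j / (j.factorial : ℝ)))

/-- The gap is empty with probability `1/2`; otherwise its closing time, a geometric sum of
exponentials of rate two, is exponential of rate one. -/
theorem geomErlang_zero (t : ℝ) : geomErlang t 0 = 1 - Real.exp (-t) / 2 := by
  simp only [geomErlang, erlang_zero_left, Finset.range_zero, Finset.sum_empty, sub_zero,
    ← Real.exp_add]
  ring_nf

/-- The closed form is `∑ k ≥ l, 2 ^ (l - k - 1) * erlang k (2 * t)` summed by parts. Later
arguments use only this recursion, the value at `0` and the bounds `0` and `1`. -/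
theorem geomErlang_eq (t : ℝ) (l : ℕ) :
    geomErlang t l = (erlang l (2 * t) + geomErlang t (l + 1)) / 2 := by
  rw [geomErlang, geomErlang, erlang_succ, Finset.sum_range_succ, mul_pow]
  ring

theorem geomErlang_le_one {t : ℝ} (ht : 0 ≤ t) (l : ℕ) : geomErlang t l ≤ 1 := by
  have h1 := erlang_le_one (mul_nonneg zero_le_two ht) l
  have h2 := sub_nonneg.2 (Real.sum_le_exp_of_nonneg ht l)
  have h3 : 0 ≤ 2 ^ l / 2 * (Real.exp (-(2 * t)) *
    (Real.exp t - ∑ j ∈ Finset.range l, t ^ j / (j.factorial : ℝ))) := by positivity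
  rw [geomErlang]
  linarith

theorem geomErlang_nonneg {t : ℝ} (ht : 0 ≤ t) (l : ℕ) : 0 ≤ geomErlang t l := by
  have h1 := exp_tail_scale ht l
  have h2 := sub_nonneg.2 (Real.sum_le_exp_of_nonneg ht l)
  have h3 : 0 ≤ 2 ^ l * (Real.exp t - ∑ j ∈ Finset.range l, t ^ j / (j.factorial : ℝ)) := by
    positivity
  have h4 : Real.exp (-(2 * t)) * Real.exp (2 * t) = 1 := by
    rw [← Real.exp_add, neg_add_cancel, Real.exp_zero]
  have h5 : geomErlang t l = Real.exp (-(2 * t)) *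
      ((Real.exp (2 * t) - ∑ j ∈ Finset.range l, (2 * t) ^ j / (j.factorial : ℝ)) -
        2 ^ l * (Real.exp t - ∑ j ∈ Finset.range l, t ^ j / (j.factorial : ℝ)) / 2) := by
    rw [geomErlang, erlang]
    linear_combination (-1) * h4
  rw [h5]
  refine mul_nonneg (Real.exp_pos _).le ?_
  linarith

/-! ### The time to fill the gaps of a path -/

/-- The possible factors of the final gap of a path, as functions of time. -/
structure IsEndFactor (E : ℝ → ℕ → ℝ) : Prop where
  hasDerivAt : ∀ t l, HasDerivAt (fun s => E s l) (E t (l - 1) - E t l) t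
  antitone : ∀ t, 0 ≤ t → Antitone (E t)
  nonneg : ∀ t, 0 ≤ t → ∀ l, 0 ≤ E t l
  le_one : ∀ t, 0 ≤ t → ∀ l, E t l ≤ 1
  one_sub_le : ∀ t, 0 ≤ t → ∀ l, 1 - E t l ≤ (4 / 3) ^ l * Real.exp (-(t / 4))

theorem isEndFactor_erlang : IsEndFactor fun t l => erlang l t where
  hasDerivAt t l := hasDerivAt_erlang l t
  antitone _ ht := erlang_antitone ht
  nonneg _ ht := erlang_nonneg ht
  le_one _ ht := erlang_le_one ht
  one_sub_le _ ht := one_sub_erlang_le ht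

theorem isEndFactor_one : IsEndFactor fun _ _ => 1 where
  hasDerivAt t _ := by simpa using hasDerivAt_const t (1 : ℝ)
  antitone _ _ := antitone_const
  nonneg _ _ _ := zero_le_one
  le_one _ _ _ := le_rfl
  one_sub_le t _ l := by
    rw [sub_self]
    positivity

/-- The factor of an inner gap of length `l`, which is filled from both ends. -/
def gapFactor (t : ℝ) (l : ℕ) : ℝ := erlang l (2 * t)

theorem gapFactor_nonneg {t : ℝ} (ht : 0 ≤ t) (l : ℕ) : 0 ≤ gapFactor t l :=
  erlang_nonneg (mul_nonneg zero_le_two ht) l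

theorem gapFactor_le_one {t : ℝ} (ht : 0 ≤ t) (l : ℕ) : gapFactor t l ≤ 1 :=
  erlang_le_one (mul_nonneg zero_le_two ht) l

theorem hasDerivAt_gapFactor (t : ℝ) (l : ℕ) :
    HasDerivAt (fun s => gapFactor s l) (2 * (gapFactor t (l - 1) - gapFactor t l)) t := by
  have := (hasDerivAt_erlang l (2 * t)).comp t ((hasDerivAt_id t).const_mul 2)
  refine this.congr_deriv ?_
  simp only [gapFactor]
  ring

theorem one_sub_gapFactor_le {t : ℝ} (ht : 0 ≤ t) (l : ℕ) :
    1 - gapFactor t l ≤ (4 / 3) ^ l * Real.exp (-(t / 4)) := by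
  refine (one_sub_erlang_le (mul_nonneg zero_le_two ht) l).trans ?_
  gcongr
  linarith

/-- The mean time, in units of the number of edges, until all gaps of the path `y` are filled. -/
def gapTime (E : ℝ → ℕ → ℝ) (y : List (Fin 2)) : ℝ :=
  ∫ t in Set.Ioi (0 : ℝ), (1 - gapProd (gapFactor t) (E t) 0 y)

section GapTime

variable {E : ℝ → ℕ → ℝ}

/-- The bound `1 - a * b ≤ (1 - a) + (1 - b)` on `[0, 1]` passes exponential decay from the factors
to the product; integrability and the limit `1` follow. -/
theorem exists_one_sub_gapProd_le (hE : IsEndFactor E) (l : ℕ) (y : List (Fin 2)) :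
    ∃ C : ℝ, ∀ t, 0 ≤ t → 1 - gapProd (gapFactor t) (E t) l y ≤ C * Real.exp (-(t / 4)) := by
  induction y generalizing l with
  | nil => exact ⟨(4 / 3) ^ l, fun t ht => hE.one_sub_le t ht l⟩
  | cons a y ih =>
    by_cases ha : a = 0
    · obtain ⟨C, hC⟩ := ih 0
      refine ⟨(4 / 3) ^ l + C, fun t ht => ?_⟩
      rw [gapProd, if_pos ha]
      have h1 := one_sub_gapFactor_le ht l
      have h2 := hC t ht
      have h3 := gapProd_le_one (gapFactor_nonneg ht) (hE.nonneg t ht) (gapFactor_le_one ht)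
        (hE.le_one t ht) 0 y
      have h4 := gapFactor_le_one ht l
      have h5 := mul_nonneg (sub_nonneg.2 h3) (sub_nonneg.2 h4)
      linarith
    · obtain ⟨C, hC⟩ := ih (l + 1)
      exact ⟨C, fun t ht => by simpa only [gapProd, ha, if_false] using hC t ht⟩

theorem hasDerivAt_gapProd_time (hE : IsEndFactor E) (l : ℕ) (y : List (Fin 2)) (t : ℝ) :
    HasDerivAt (fun s => gapProd (gapFactor s) (E s) l y)
      (gapProd (gapFactor t) (E t) (l - 1) y - gapProd (gapFactor t) (E t) l y +
        ∑ j ∈ Finset.range y.length, (gapStep (gapFactor t) (E t) l y j -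
          gapProd (gapFactor t) (E t) l y)) t :=
  hasDerivAt_gapProd (F := gapFactor) (hasDerivAt_gapFactor t) (hE.hasDerivAt t)
    (erlang_zero_left _) l y

theorem continuous_gapProd (hE : IsEndFactor E) (l : ℕ) (y : List (Fin 2)) :
    Continuous fun t => gapProd (gapFactor t) (E t) l y :=
  continuous_iff_continuousAt.2 fun t => (hasDerivAt_gapProd_time hE l y t).continuousAt

theorem integrableOn_exp_div_four :
    IntegrableOn (fun t : ℝ => Real.exp (-(t / 4))) (Set.Ioi 0) := by
  have := exp_neg_integrableOn_Ioi 0 (b := 1 / 4) (by norm_num)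
  refine this.congr_fun (fun t _ => ?_) measurableSet_Ioi
  ring_nf

theorem integrableOn_gapProd (hE : IsEndFactor E) (l : ℕ) (y : List (Fin 2)) :
    IntegrableOn (fun t => 1 - gapProd (gapFactor t) (E t) l y) (Set.Ioi 0) := by
  obtain ⟨C, hC⟩ := exists_one_sub_gapProd_le hE l y
  refine (integrableOn_exp_div_four.const_mul C).mono'
    (continuous_const.sub (continuous_gapProd hE l y)).aestronglyMeasurable ?_
  refine (ae_restrict_iff' measurableSet_Ioi).2 (Eventually.of_forall fun t ht => ?_)
  have ht : 0 ≤ t := le_of_lt ht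
  rw [Real.norm_of_nonneg (sub_nonneg.2 (gapProd_le_one (gapFactor_nonneg ht) (hE.nonneg t ht)
    (gapFactor_le_one ht) (hE.le_one t ht) l y))]
  exact hC t ht

theorem tendsto_gapProd (hE : IsEndFactor E) (l : ℕ) (y : List (Fin 2)) :
    Tendsto (fun t => gapProd (gapFactor t) (E t) l y) atTop (𝓝 1) := by
  obtain ⟨C, hC⟩ := exists_one_sub_gapProd_le hE l y
  have h1 : Tendsto (fun t : ℝ => 1 - C * Real.exp (-(t / 4))) atTop (𝓝 (1 - C * 0)) :=
    tendsto_const_nhds.sub ((Real.tendsto_exp_neg_atTop_nhds_zero.comp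
      (tendsto_id.atTop_div_const (by norm_num))).const_mul C)
  rw [mul_zero, sub_zero] at h1
  refine tendsto_of_tendsto_of_tendsto_of_le_of_le' h1 tendsto_const_nhds ?_ ?_
  · filter_upwards [eventually_ge_atTop 0] with t ht
    have := hC t ht
    linarith
  · filter_upwards [eventually_ge_atTop 0] with t ht
    exact gapProd_le_one (gapFactor_nonneg ht) (hE.nonneg t ht)
      (gapFactor_le_one ht) (hE.le_one t ht) l y

theorem gapTime_nonneg (hE : IsEndFactor E) (y : List (Fin 2)) : 0 ≤ gapTime E y :=
  setIntegral_nonneg measurableSet_Ioi fun t ht =>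
    sub_nonneg.2 (gapProd_le_one (gapFactor_nonneg (le_of_lt ht)) (hE.nonneg t (le_of_lt ht))
      (gapFactor_le_one (le_of_lt ht)) (hE.le_one t (le_of_lt ht)) 0 y)

theorem gapTime_pathStep_le (hE : IsEndFactor E) (y : List (Fin 2)) {j : ℕ} (hj : j < y.length) :
    gapTime E (pathStep j y) ≤ gapTime E y := by
  refine setIntegral_mono_on (integrableOn_gapProd hE 0 _) (integrableOn_gapProd hE 0 y)
    measurableSet_Ioi fun t ht => sub_le_sub_left ?_ 1
  have ht : 0 ≤ t := le_of_lt ht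
  rw [← gapStep_eq (erlang_zero_left _) y 0 j hj (Or.inr rfl)]
  exact gapProd_le_gapStep (fun a b hab => erlang_antitone (mul_nonneg zero_le_two ht) hab)
    (hE.antitone t ht) (gapFactor_nonneg ht) (hE.nonneg t ht) (erlang_zero_left _) y 0 j

/-- The backward equation integrated over `(0, ∞)`: the product rises from its value at time `0` to
`1`. -/
theorem sum_gapTime_sub (hE : IsEndFactor E) (y : List (Fin 2)) :
    ∑ j ∈ Finset.range y.length, (gapTime E y - gapTime E (pathStep j y)) =
      1 - gapProd (gapFactor 0) (E 0) 0 y := by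
  have hint : ∀ j ∈ Finset.range y.length, IntegrableOn (fun t =>
      gapProd (gapFactor t) (E t) 0 (pathStep j y) - gapProd (gapFactor t) (E t) 0 y)
      (Set.Ioi 0) := fun j _ => by
    refine ((integrableOn_gapProd hE 0 y).sub (integrableOn_gapProd hE 0 (pathStep j y))).congr_fun
      (fun t _ => ?_) measurableSet_Ioi
    simp only [Pi.sub_apply]
    ring
  have h1 : ∀ j ∈ Finset.range y.length, gapTime E y - gapTime E (pathStep j y) =
      ∫ t in Set.Ioi (0 : ℝ), (gapProd (gapFactor t) (E t) 0 (pathStep j y) -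
        gapProd (gapFactor t) (E t) 0 y) := fun j _ => by
    rw [gapTime, gapTime, ← integral_sub (integrableOn_gapProd hE 0 y)
      (integrableOn_gapProd hE 0 _)]
    refine setIntegral_congr_fun measurableSet_Ioi fun t _ => ?_
    ring
  rw [Finset.sum_congr rfl h1, ← integral_finsetSum _ hint]
  refine integral_Ioi_of_hasDerivAt_of_tendsto
    (continuous_gapProd hE 0 y).continuousWithinAt (fun t _ => ?_)
    (integrable_finsetSum _ hint) (tendsto_gapProd hE 0 y)
  refine (hasDerivAt_gapProd_time hE 0 y t).congr_deriv ?_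
  -- The path is preceded by a low vertex, so truncated subtraction removes the left-end term.
  rw [Nat.zero_sub, sub_self, zero_add]
  refine Finset.sum_congr rfl fun j hj => ?_
  rw [gapStep_eq (erlang_zero_left _) y 0 j (Finset.mem_range.1 hj) (Or.inr rfl)]

theorem gapProd_zero_eq_zero (hE : ∀ l, l ≠ 0 → E 0 l = 0) (l : ℕ) (y : List (Fin 2))
    (h : l ≠ 0 ∨ 1 ∈ y) : gapProd (gapFactor 0) (E 0) l y = 0 := by
  induction y generalizing l with
  | nil => exact hE l (by simpa using h)
  | cons a y ih =>
    rw [gapProd]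
    split_ifs with ha
    · by_cases hl : l = 0
      · rw [ih 0 (Or.inr (by simpa [hl, ha] using h)), mul_zero]
      · rw [gapFactor, mul_zero, erlang_zero_right hl, zero_mul]
    · exact ih _ (Or.inl (Nat.succ_ne_zero l))

theorem average_gapTime (hE : IsEndFactor E) (r : ℕ) :
    average (fun y : Fin r → Fin 2 => gapTime E (List.ofFn y)) =
      ∫ t in Set.Ioi (0 : ℝ), (1 - avgGap (gapFactor t) (E t) r 0) := by
  simp only [gapTime, average]
  rw [← integral_finsetSum _ fun y _ => integrableOn_gapProd hE 0 (List.ofFn y),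
    ← integral_const_mul]
  refine integral_congr_ae (Eventually.of_forall fun t => ?_)
  simp only
  rw [← average_gapProd]
  have := average_const (ι := Fin r → Fin 2) 1
  simp only [average] at this ⊢
  rw [Finset.sum_sub_distrib, mul_sub, this]

theorem integrableOn_avgGap (hE : IsEndFactor E) (r : ℕ) :
    IntegrableOn (fun t => 1 - avgGap (gapFactor t) (E t) r 0) (Set.Ioi 0) := by
  have h1 := (integrable_finsetSum Finset.univ fun (y : Fin r → Fin 2) _ =>
    integrableOn_gapProd hE 0 (List.ofFn y)).const_mul (Fintype.card (Fin r → Fin 2) : ℝ)⁻¹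
  refine h1.congr (Eventually.of_forall fun t => ?_)
  simp only
  rw [← average_gapProd]
  have := average_const (ι := Fin r → Fin 2) 1
  simp only [average] at this ⊢
  rw [Finset.sum_sub_distrib, mul_sub, this]

end GapTime

/-! ### Asymptotics of the time to fill the gaps -/

theorem hasDerivAt_geomErlang_zero (t : ℝ) :
    HasDerivAt (fun s : ℝ => 1 - Real.exp (-s) / 2) (Real.exp (-t) / 2) t := by
  have hexp : HasDerivAt (fun s : ℝ => Real.exp (-s)) (-Real.exp (-t)) t := by
    simpa using (hasDerivAt_neg t).exp
  refine ((hasDerivAt_const t (1 : ℝ)).sub (hexp.div_const 2)).congr_deriv ?_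
  ring

theorem tendsto_geomErlang_zero :
    Tendsto (fun t : ℝ => 1 - Real.exp (-t) / 2) atTop (𝓝 1) := by
  simpa using (Real.tendsto_exp_neg_atTop_nhds_zero.div_const 2).const_sub 1

theorem half_le_geomErlang {t : ℝ} (ht : 0 ≤ t) : 1 / 2 ≤ 1 - Real.exp (-t) / 2 := by
  have : Real.exp (-t) ≤ 1 := Real.exp_le_one_iff.2 (by linarith)
  linarith

theorem geomErlang_lt_one (t : ℝ) : 1 - Real.exp (-t) / 2 < 1 := by
  have := Real.exp_pos (-t)
  linarith

theorem one_sub_pow_le {t : ℝ} (ht : 0 ≤ t) (M : ℕ) :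
    1 - (1 - Real.exp (-t) / 2) ^ M ≤ M / 2 * Real.exp (-t) := by
  have h := one_add_mul_le_pow (a := -(Real.exp (-t) / 2)) (by
    have := half_le_geomErlang ht
    linarith) M
  rw [← sub_eq_add_neg] at h
  linarith

theorem integrableOn_one_sub_pow (M : ℕ) :
    IntegrableOn (fun t : ℝ => 1 - (1 - Real.exp (-t) / 2) ^ M) (Set.Ioi 0) := by
  refine ((exp_neg_integrableOn_Ioi 0 one_pos).const_mul ((M : ℝ) / 2)).mono'
    (by fun_prop) ?_
  refine (ae_restrict_iff' measurableSet_Ioi).2 (Eventually.of_forall fun t ht => ?_)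
  have ht : 0 ≤ t := le_of_lt ht
  have h1 := half_le_geomErlang ht
  rw [Real.norm_of_nonneg (sub_nonneg.2
    (pow_le_one₀ (by linarith) (geomErlang_lt_one t).le)), neg_one_mul]
  exact one_sub_pow_le ht M

/-- With `u = 1 - exp (-t) / 2` one has `u' = 1 - u`, so consecutive integrands differ by the
derivative of `u ^ (M + 1) / (M + 1)`, and `u` runs from `1/2` to `1`. -/
theorem integral_one_sub_pow (M : ℕ) :
    ∫ t in Set.Ioi (0 : ℝ), (1 - (1 - Real.exp (-t) / 2) ^ M) = binomialHarmonic M := by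
  induction M with
  | zero => simp [binomialHarmonic]
  | succ M ih =>
    have h1 : ∫ t in Set.Ioi (0 : ℝ), ((1 - (1 - Real.exp (-t) / 2) ^ (M + 1)) -
        (1 - (1 - Real.exp (-t) / 2) ^ M)) = (1 - (2 ^ (M + 1))⁻¹) / ((M : ℝ) + 1) := by
      have h2 : Tendsto (fun t : ℝ => (1 - Real.exp (-t) / 2) ^ (M + 1) / ((M : ℝ) + 1)) atTop
          (𝓝 (1 / ((M : ℝ) + 1))) := by
        simpa using (tendsto_geomErlang_zero.pow (M + 1)).div_const ((M : ℝ) + 1)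
      have h3 : ∀ t : ℝ, HasDerivAt
          (fun t : ℝ => (1 - Real.exp (-t) / 2) ^ (M + 1) / ((M : ℝ) + 1))
          ((1 - (1 - Real.exp (-t) / 2) ^ (M + 1)) - (1 - (1 - Real.exp (-t) / 2) ^ M)) t := by
        intro t
        refine (((hasDerivAt_geomErlang_zero t).pow (M + 1)).div_const _).congr_deriv ?_
        rw [Nat.add_sub_cancel]
        push_cast
        field_simp
        ring
      rw [integral_Ioi_of_hasDerivAt_of_tendsto (h3 0).continuousAt.continuousWithinAt
        (fun t _ => h3 t) ((integrableOn_one_sub_pow (M + 1)).sub (integrableOn_one_sub_pow M)) h2]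
      rw [neg_zero, Real.exp_zero, show (1 : ℝ) - 1 / 2 = 2⁻¹ by norm_num, inv_pow]
      ring
    rw [integral_sub (integrableOn_one_sub_pow (M + 1)) (integrableOn_one_sub_pow M), ih] at h1
    rw [binomialHarmonic, Finset.sum_range_succ, ← binomialHarmonic]
    linarith

/-- The Chebyshev error does not decay in `t`, so it is used only up to a cutoff `T`, and a crude
exponential bound beyond. -/
theorem setIntegral_le_add {f g : ℝ → ℝ} (hf : IntegrableOn f (Set.Ioi 0))
    (hg : IntegrableOn g (Set.Ioi 0)) {T β K : ℝ} (hT : 0 ≤ T)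
    (h1 : ∀ t, 0 < t → t ≤ T → f t ≤ g t + β)
    (h2 : ∀ t, T < t → f t ≤ g t + K * Real.exp (-t)) :
    ∫ t in Set.Ioi (0 : ℝ), f t ≤ (∫ t in Set.Ioi (0 : ℝ), g t) + (β * T + K * Real.exp (-T)) := by
  have hexp : ∀ a : ℝ, IntegrableOn (fun t : ℝ => K * Real.exp (-t)) (Set.Ioi a) := fun a => by
    have := (exp_neg_integrableOn_Ioi a one_pos).const_mul K
    simpa [IntegrableOn] using this
  have hIoc : ∫ t in Set.Ioc 0 T, f t ≤ (∫ t in Set.Ioc 0 T, g t) + β * T := by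
    have hg' := hg.mono_set (Set.Ioc_subset_Ioi_self : Set.Ioc 0 T ⊆ Set.Ioi 0)
    have hc : IntegrableOn (fun _ => β) (Set.Ioc 0 T) := by simp
    refine (setIntegral_mono_on (hf.mono_set Set.Ioc_subset_Ioi_self)
      (hg'.add hc) measurableSet_Ioc fun t ht => h1 t ht.1 ht.2).trans_eq ?_
    rw [integral_add' hg' hc]
    simp [hT, mul_comm]
  have hIoi : ∫ t in Set.Ioi T, f t ≤ (∫ t in Set.Ioi T, g t) + K * Real.exp (-T) := by
    have hg' := hg.mono_set (Set.Ioi_subset_Ioi hT)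
    refine (setIntegral_mono_on (hf.mono_set (Set.Ioi_subset_Ioi hT))
      (hg'.add (hexp T)) measurableSet_Ioi fun t ht => h2 t ht).trans_eq ?_
    rw [integral_add' hg' (hexp T), integral_const_mul, integral_exp_neg_Ioi]
  rw [← Set.Ioc_union_Ioi_eq_Ioi hT]
  rw [setIntegral_union (Set.Ioc_disjoint_Ioi le_rfl) measurableSet_Ioi
      (hf.mono_set Set.Ioc_subset_Ioi_self) (hf.mono_set (Set.Ioi_subset_Ioi hT)),
    setIntegral_union (Set.Ioc_disjoint_Ioi le_rfl) measurableSet_Ioi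
      (hg.mono_set Set.Ioc_subset_Ioi_self) (hg.mono_set (Set.Ioi_subset_Ioi hT))]
  linarith

/-- The survival function of the filling of a path with `r` vertices, without its final gap. -/
def innerGap (r : ℕ) (t : ℝ) : ℝ := avgGap (gapFactor t) (fun _ => 1) r 0

theorem innerGap_nonneg {t : ℝ} (ht : 0 ≤ t) (r : ℕ) : 0 ≤ innerGap r t :=
  avgGap_nonneg (gapFactor_nonneg ht) (fun _ => zero_le_one) r 0

theorem innerGap_le_one {t : ℝ} (ht : 0 ≤ t) (r : ℕ) : innerGap r t ≤ 1 :=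
  avgGap_le_one (gapFactor_nonneg ht) (fun _ => zero_le_one) (gapFactor_le_one ht)
    (fun _ => le_rfl) r 0

theorem innerGap_le {t : ℝ} (ht : 0 ≤ t) {r M : ℕ} {δ : ℝ} (hδ : 0 < δ)
    (hM : (M : ℝ) + δ ≤ r / 2) :
    innerGap r t ≤ (1 - Real.exp (-t) / 2) ^ M + r / (4 * δ ^ 2) := by
  -- With this width the squared bias in the Chebyshev error vanishes.
  have hδ' : 0 < (r : ℝ) / 2 - M := by linarith
  have h := avgGap_le (gapFactor_nonneg ht) (gapFactor_le_one ht) (geomErlang_nonneg ht)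
    (geomErlang_eq t) hδ' r M 0
  rw [geomGap_zero, geomErlang_zero, sub_self, zero_pow two_ne_zero, add_zero] at h
  refine h.trans (add_le_add_right ?_ _)
  rw [div_div]
  gcongr
  linarith

theorem le_innerGap {t : ℝ} (ht : 0 ≤ t) {r M : ℕ} {δ : ℝ} (hδ : 0 < δ)
    (hM : (r : ℝ) / 2 + δ ≤ M) :
    (1 - Real.exp (-t) / 2) ^ M - r / (4 * δ ^ 2) ≤ innerGap r t := by
  have hδ' : 0 < (M : ℝ) - r / 2 := by linarith
  have h := le_avgGap (gapFactor_nonneg ht) (gapFactor_le_one ht) (geomErlang_nonneg ht)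
    (geomErlang_le_one ht) (geomErlang_eq t) hδ' r M 0
  rw [geomGap_zero, geomErlang_zero, show (r : ℝ) / 2 - M + (M - r / 2) = 0 by ring,
    zero_pow two_ne_zero, add_zero] at h
  refine le_trans (sub_le_sub_left ?_ _) h
  rw [div_div]
  gcongr
  linarith

theorem pow_le_innerGap {t : ℝ} (ht : 0 ≤ t) (r : ℕ) :
    (1 - Real.exp (-t) / 2) ^ (r + 1) ≤ innerGap r t := by
  have h := geomGap_le_avgGap (gapFactor_nonneg ht) (geomErlang_nonneg ht)
    (geomErlang_le_one ht) (geomErlang_eq t) (Nat.lt_succ_self r) 0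
  rwa [geomGap_zero, geomErlang_zero] at h

theorem le_integral_innerGap {r M : ℕ} {δ T : ℝ} (hδ : 0 < δ) (hT : 0 ≤ T)
    (hM : (M : ℝ) + δ ≤ r / 2) :
    binomialHarmonic M - (r / (4 * δ ^ 2) * T + M / 2 * Real.exp (-T)) ≤
      ∫ t in Set.Ioi (0 : ℝ), (1 - innerGap r t) := by
  have h := setIntegral_le_add (integrableOn_one_sub_pow M)
    (integrableOn_avgGap isEndFactor_one r) hT (β := r / (4 * δ ^ 2)) (K := M / 2)
    (fun t ht _ => by
      have := innerGap_le ht.le hδ hM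
      rw [innerGap] at this
      linarith)
    (fun t ht => by
      have ht : 0 ≤ t := hT.trans ht.le
      have h1 := innerGap_le_one ht r
      have h2 := one_sub_pow_le ht M
      rw [innerGap] at h1
      linarith)
  rw [integral_one_sub_pow] at h
  simp only [innerGap]
  linarith

theorem integral_innerGap_le {r M : ℕ} {δ T : ℝ} (hδ : 0 < δ) (hT : 0 ≤ T)
    (hM : (r : ℝ) / 2 + δ ≤ M) :
    ∫ t in Set.Ioi (0 : ℝ), (1 - innerGap r t) ≤
      binomialHarmonic M + (r / (4 * δ ^ 2) * T + ((r + 1 : ℕ) : ℝ) / 2 * Real.exp (-T)) := by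
  rw [← integral_one_sub_pow]
  refine setIntegral_le_add (integrableOn_avgGap isEndFactor_one r)
    (integrableOn_one_sub_pow M) hT (fun t ht _ => ?_) fun t ht => ?_
  · have := le_innerGap ht.le hδ hM
    rw [innerGap] at this
    linarith
  · have ht : 0 ≤ t := hT.trans ht.le
    -- Beyond `T` the exponent `r + 1` gives a bound without Chebyshev error.
    have h1 := pow_le_innerGap ht r
    rw [innerGap] at h1
    have h2 := one_sub_pow_le ht (r + 1)
    have h3 : (1 - Real.exp (-t) / 2) ^ M ≤ 1 :=
      pow_le_one₀ (by linarith [half_le_geomErlang ht]) (geomErlang_lt_one t).le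
    linarith

/-- One `log 2` comes from the binomial average, the other from `h(M r) - h(r) → log (1 / 2)`. -/
theorem tendsto_binomialHarmonic_sub_of_ratio {M : ℕ → ℕ} (hM : Tendsto M atTop atTop)
    (hr : Tendsto (fun r => (M r : ℝ) / r) atTop (𝓝 (1 / 2))) :
    Tendsto (fun r => binomialHarmonic (M r) - (harmonic r : ℝ)) atTop (𝓝 (-Real.log 4)) := by
  have h1 := tendsto_binomialHarmonic_sub.comp hM
  have h2 := Real.tendsto_harmonic_sub_log.comp hM
  have h3 := Real.tendsto_harmonic_sub_log
  have h4 := hr.log (by norm_num)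
  have h5 := ((h1.add h2).sub h3).add h4
  have h6 : -Real.log 2 + Real.eulerMascheroniConstant - Real.eulerMascheroniConstant +
      Real.log (1 / 2) = -Real.log 4 := by
    rw [show (4 : ℝ) = 2 * 2 by norm_num, Real.log_mul two_ne_zero two_ne_zero, one_div,
      Real.log_inv]
    ring
  rw [h6] at h5
  refine h5.congr' ?_
  filter_upwards [hM.eventually_gt_atTop 0, eventually_gt_atTop 0] with r hMr hr0
  have : ((M r : ℕ) : ℝ) ≠ 0 := by exact_mod_cast hMr.ne'
  have h7 : (r : ℝ) ≠ 0 := by exact_mod_cast hr0.ne'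
  simp only [Function.comp_apply, Real.log_div this h7]
  ring

/-! ### Concentration of the number of gaps around `r/2`. -/

/-- The width of the window around its mean outside which the number of gaps is neglected. -/
def window (r : ℕ) : ℝ := (r : ℝ) ^ (3 / 4 : ℝ)

theorem window_pos {r : ℕ} (hr : 0 < r) : 0 < window r :=
  Real.rpow_pos_of_pos (by exact_mod_cast hr) _

theorem tendsto_window_div : Tendsto (fun r : ℕ => window r / r) atTop (𝓝 0) := by
  have h := (tendsto_rpow_neg_atTop (y := 1 / 4) (by norm_num)).comp
    (tendsto_natCast_atTop_atTop (R := ℝ))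
  refine h.congr' ?_
  filter_upwards [eventually_gt_atTop 0] with r hr
  have hr : (0 : ℝ) < r := by exact_mod_cast hr
  rw [Function.comp_apply, window, eq_div_iff hr.ne', ← Real.rpow_add_one hr.ne']
  norm_num

/-- The exponent `3 / 4` is small enough for `window r = o(r)` and large enough for this error,
which is `log r / (2 * √r)`. -/
theorem tendsto_window_error :
    Tendsto (fun r : ℕ => (r : ℝ) / (4 * window r ^ 2) * (2 * Real.log r)) atTop (𝓝 0) := by
  have h := (((isLittleO_log_rpow_atTop (r := 1 / 2) (by norm_num)).tendsto_div_nhds_zero).comp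
    (tendsto_natCast_atTop_atTop (R := ℝ))).const_mul (1 / 2)
  rw [mul_zero] at h
  refine h.congr' ?_
  filter_upwards [eventually_gt_atTop 0] with r hr
  have hr : (0 : ℝ) < r := by exact_mod_cast hr
  have h1 : window r ^ 2 = (r : ℝ) * (r : ℝ) ^ (1 / 2 : ℝ) := by
    rw [window, ← Real.rpow_natCast, ← Real.rpow_mul hr.le]
    nth_rewrite 2 [← Real.rpow_one (r : ℝ)]
    rw [← Real.rpow_add hr]
    norm_num
  rw [h1, Function.comp_apply]
  have : (0 : ℝ) < (r : ℝ) ^ (1 / 2 : ℝ) := Real.rpow_pos_of_pos hr _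
  field_simp
  ring

theorem tendsto_window_ratio_error :
    Tendsto (fun r : ℕ => (r : ℝ) / (4 * window r ^ 2)) atTop (𝓝 0) := by
  refine tendsto_of_tendsto_of_tendsto_of_le_of_le' tendsto_const_nhds tendsto_window_error
    (Eventually.of_forall fun r => by positivity) ?_
  filter_upwards [(Real.tendsto_log_atTop.comp
    (tendsto_natCast_atTop_atTop (R := ℝ))).eventually_ge_atTop 1] with r hr
  have h1 : (1 : ℝ) ≤ 2 * Real.log r := by
    have : 1 ≤ Real.log r := hr
    linarith
  exact le_mul_of_one_le_right (by positivity) h1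

/-- A lower bound for the typical number of gaps. -/
def lowerGaps (r : ℕ) : ℕ := ⌊(r : ℝ) / 2 - window r⌋₊

/-- An upper bound for the typical number of gaps. -/
def upperGaps (r : ℕ) : ℕ := ⌈(r : ℝ) / 2 + window r⌉₊

theorem eventually_window_le : ∀ᶠ r : ℕ in atTop, 0 ≤ (r : ℝ) / 2 - window r := by
  filter_upwards [tendsto_window_div.eventually_le_const (show (0 : ℝ) < 1 / 2 by norm_num),
    eventually_gt_atTop 0] with r h hr
  have hr : (0 : ℝ) < r := by exact_mod_cast hr
  rw [div_le_iff₀ hr] at h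
  linarith

theorem tendsto_lowerGaps_div :
    Tendsto (fun r => (lowerGaps r : ℝ) / r) atTop (𝓝 (1 / 2)) := by
  have h1 := tendsto_window_div.const_sub (1 / 2)
  have h2 := h1.sub (tendsto_one_div_atTop_nhds_zero_nat : Tendsto (fun n : ℕ => 1 / (n : ℝ)) _ _)
  rw [sub_zero] at h1
  rw [sub_zero, sub_zero] at h2
  refine tendsto_of_tendsto_of_tendsto_of_le_of_le' h2 h1 ?_ ?_
  · filter_upwards [eventually_gt_atTop 0] with r hr
    have hr : (0 : ℝ) < r := by exact_mod_cast hr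
    have h3 : (r : ℝ) / 2 - window r ≤ (lowerGaps r : ℝ) + 1 := (Nat.lt_floor_add_one ((r : ℝ) / 2 - window r)).le
    rw [le_div_iff₀ hr]
    have h4 : ((1 : ℝ) / 2 - window r / r - 1 / r) * r = r / 2 - window r - 1 := by
      field_simp
    linarith
  · filter_upwards [eventually_gt_atTop 0, eventually_window_le] with r hr h
    have hr : (0 : ℝ) < r := by exact_mod_cast hr
    have h3 : (lowerGaps r : ℝ) ≤ (r : ℝ) / 2 - window r := Nat.floor_le h
    rw [div_le_iff₀ hr]
    have h4 : ((1 : ℝ) / 2 - window r / r) * r = r / 2 - window r := by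
      field_simp
    linarith

theorem tendsto_upperGaps_div :
    Tendsto (fun r => (upperGaps r : ℝ) / r) atTop (𝓝 (1 / 2)) := by
  have h1 := tendsto_window_div.const_add (1 / 2)
  have h2 := h1.add (tendsto_one_div_atTop_nhds_zero_nat : Tendsto (fun n : ℕ => 1 / (n : ℝ)) _ _)
  rw [add_zero] at h1
  rw [add_zero, add_zero] at h2
  refine tendsto_of_tendsto_of_tendsto_of_le_of_le' h1 h2 ?_ ?_
  · filter_upwards [eventually_gt_atTop 0] with r hr
    have hr : (0 : ℝ) < r := by exact_mod_cast hr
    have h3 : (r : ℝ) / 2 + window r ≤ (upperGaps r : ℝ) := Nat.le_ceil ((r : ℝ) / 2 + window r)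
    rw [le_div_iff₀ hr]
    have h4 : ((1 : ℝ) / 2 + window r / r) * r = r / 2 + window r := by
      field_simp
    linarith
  · filter_upwards [eventually_gt_atTop 0] with r hr
    have h0 := window_pos hr
    have hr : (0 : ℝ) < r := by exact_mod_cast hr
    have h3 : (upperGaps r : ℝ) ≤ (r : ℝ) / 2 + window r + 1 :=
      (Nat.ceil_lt_add_one (show 0 ≤ (r : ℝ) / 2 + window r by positivity)).le
    rw [div_le_iff₀ hr]
    have h4 : ((1 : ℝ) / 2 + window r / r + 1 / r) * r = r / 2 + window r + 1 := by
      field_simp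
    linarith

theorem tendsto_atTop_of_ratio {M : ℕ → ℕ}
    (hr : Tendsto (fun r => (M r : ℝ) / r) atTop (𝓝 (1 / 2))) : Tendsto M atTop atTop := by
  refine tendsto_natCast_atTop_iff (R := ℝ).1 ?_
  refine (hr.pos_mul_atTop (by norm_num) tendsto_natCast_atTop_atTop).congr' ?_
  filter_upwards [eventually_gt_atTop 0] with r hr
  have hr : (r : ℝ) ≠ 0 := by exact_mod_cast hr.ne'
  field_simp

theorem tendsto_tail_error {M : ℕ → ℕ}
    (hr : Tendsto (fun r => (M r : ℝ) / r) atTop (𝓝 (1 / 2))) :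
    Tendsto (fun r : ℕ => (M r : ℝ) / 2 * Real.exp (-(2 * Real.log r))) atTop (𝓝 0) := by
  have h := (hr.mul (tendsto_one_div_atTop_nhds_zero_nat :
    Tendsto (fun n : ℕ => 1 / (n : ℝ)) _ _)).div_const 2
  rw [mul_zero, zero_div] at h
  refine h.congr' ?_
  filter_upwards [eventually_gt_atTop 0] with r hr
  have hr : (0 : ℝ) < r := by exact_mod_cast hr
  rw [two_mul, neg_add, Real.exp_add, Real.exp_neg, Real.exp_log hr]
  field_simp

/-- The cutoff `T = 2 * log r` makes `exp (-T) = r ^ (-2)`, so the tail errors are of order `1 / r`.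
-/
theorem tendsto_integral_innerGap :
    Tendsto (fun r => (∫ t in Set.Ioi (0 : ℝ), (1 - innerGap r t)) - (harmonic r : ℝ)) atTop
      (𝓝 (-Real.log 4)) := by
  have hlo := (tendsto_binomialHarmonic_sub_of_ratio
    (tendsto_atTop_of_ratio tendsto_lowerGaps_div) tendsto_lowerGaps_div).sub
      (tendsto_window_error.add (tendsto_tail_error tendsto_lowerGaps_div))
  have hup1 : Tendsto (fun r : ℕ => ((r + 1 : ℕ) : ℝ) / 2 * Real.exp (-(2 * Real.log r))) atTop
      (𝓝 0) := by
    have h := ((tendsto_one_div_atTop_nhds_zero_nat :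
      Tendsto (fun n : ℕ => 1 / (n : ℝ)) _ _))
    have h2 := (h.add (h.mul h)).div_const 2
    simp only [mul_zero, add_zero, zero_div] at h2
    refine h2.congr' ?_
    filter_upwards [eventually_gt_atTop 0] with r hr
    have hr : (0 : ℝ) < r := by exact_mod_cast hr
    rw [two_mul, neg_add, Real.exp_add, Real.exp_neg, Real.exp_log hr]
    push_cast
    field_simp
  have hup := (tendsto_binomialHarmonic_sub_of_ratio
    (tendsto_atTop_of_ratio tendsto_upperGaps_div) tendsto_upperGaps_div).add
      (tendsto_window_error.add hup1)
  rw [add_zero, sub_zero] at hlo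
  rw [add_zero, add_zero] at hup
  refine tendsto_of_tendsto_of_tendsto_of_le_of_le' hlo hup ?_ ?_
  · filter_upwards [eventually_gt_atTop 0, eventually_window_le] with r hr h
    have h1 := le_integral_innerGap (r := r) (M := lowerGaps r) (window_pos hr)
      (T := 2 * Real.log r) (by have := Real.log_natCast_nonneg r; positivity)
      (by have := Nat.floor_le h; rw [lowerGaps]; linarith)
    linarith
  · filter_upwards [eventually_gt_atTop 0] with r hr
    have h1 := integral_innerGap_le (r := r) (M := upperGaps r) (window_pos hr)
      (T := 2 * Real.log r) (by have := Real.log_natCast_nonneg r; positivity)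
      (Nat.le_ceil _)
    linarith

theorem tendsto_innerGap {t : ℝ} (ht : 0 ≤ t) : Tendsto (fun r => innerGap r t) atTop (𝓝 0) := by
  have h1 := (tendsto_pow_atTop_nhds_zero_of_lt_one
    (by linarith [half_le_geomErlang ht]) (geomErlang_lt_one t)).comp
      (tendsto_atTop_of_ratio tendsto_lowerGaps_div)
  have h2 := h1.add tendsto_window_ratio_error
  rw [add_zero] at h2
  refine tendsto_of_tendsto_of_tendsto_of_le_of_le' tendsto_const_nhds h2
    (Eventually.of_forall fun r => innerGap_nonneg ht r) ?_
  filter_upwards [eventually_gt_atTop 0, eventually_window_le] with r hr h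
  have h3 : (lowerGaps r : ℝ) + window r ≤ r / 2 := by
    have := Nat.floor_le h
    rw [lowerGaps]
    linarith
  exact innerGap_le ht (window_pos hr) h3

/-- At a fixed time the inner gaps are all closed with vanishing probability, so the final gap
rarely matters; `3 / 2 * exp (-(t / 4))` dominates the difference uniformly in `r`. -/
theorem tendsto_integral_endGap :
    Tendsto (fun r => ∫ t in Set.Ioi (0 : ℝ),
      (innerGap r t - avgGap (gapFactor t) (fun l => erlang l t) r 0)) atTop (𝓝 0) := by
  have hb : ∀ {t : ℝ}, 0 ≤ t → ∀ r,
      0 ≤ avgGap (gapFactor t) (fun l => erlang l t) r 0 ∧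
      avgGap (gapFactor t) (fun l => erlang l t) r 0 ≤ innerGap r t := by
    intro t ht r
    refine ⟨avgGap_nonneg (gapFactor_nonneg ht) (erlang_nonneg ht) r 0, ?_⟩
    have : ∀ l, avgGap (gapFactor t) (fun l => erlang l t) r l ≤
        avgGap (gapFactor t) (fun _ => 1) r l := by
      induction r with
      | zero => exact fun l => erlang_le_one ht l
      | succ r ih =>
        intro l
        rw [avgGap, avgGap]
        have h1 := mul_le_mul_of_nonneg_left (ih 0) (gapFactor_nonneg ht l)
        have h2 := ih (l + 1)
        linarith
    exact this 0
  have hD := tendsto_integral_of_dominated_convergence (μ := volume.restrict (Set.Ioi (0 : ℝ)))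
    (F := fun r t => innerGap r t - avgGap (gapFactor t) (fun l => erlang l t) r 0)
    (f := fun _ => (0 : ℝ)) (fun t => 3 / 2 * Real.exp (-(t / 4))) (fun r => ?_)
    (integrableOn_exp_div_four.const_mul (3 / 2)) (fun r => ?_) ?_
  · simpa using hD
  · have h1 := (integrableOn_avgGap isEndFactor_erlang r).sub
      (integrableOn_avgGap isEndFactor_one r)
    refine h1.aestronglyMeasurable.congr (Eventually.of_forall fun t => ?_)
    simp only [Pi.sub_apply, innerGap]
    ring
  · refine (ae_restrict_iff' measurableSet_Ioi).2 (Eventually.of_forall fun t ht => ?_)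
    have ht : 0 ≤ t := le_of_lt ht
    rw [Real.norm_of_nonneg (sub_nonneg.2 (hb ht r).2)]
    exact avgGap_zero_sub_le (gapFactor_nonneg ht) (gapFactor_le_one ht) (Real.exp_pos _).le
      (one_sub_erlang_le ht) r
  · refine (ae_restrict_iff' measurableSet_Ioi).2 (Eventually.of_forall fun t ht => ?_)
    have ht : 0 ≤ t := le_of_lt ht
    refine tendsto_of_tendsto_of_tendsto_of_le_of_le tendsto_const_nhds (tendsto_innerGap ht)
      (fun r => sub_nonneg.2 (hb ht r).2) fun r => ?_
    have := (hb ht r).1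
    simp only
    linarith

/-- The average of `gapTime` over the paths with `r` vertices. -/
def avgGapTime (E : ℝ → ℕ → ℝ) (r : ℕ) : ℝ :=
  average fun y : Fin r → Fin 2 => gapTime E (List.ofFn y)

theorem tendsto_avgGapTime_one :
    Tendsto (fun r => avgGapTime (fun _ _ => 1) r - (harmonic r : ℝ)) atTop
      (𝓝 (-Real.log 4)) := by
  simp only [avgGapTime, average_gapTime isEndFactor_one]
  exact tendsto_integral_innerGap

theorem tendsto_avgGapTime_erlang :
    Tendsto (fun r => avgGapTime (fun t l => erlang l t) r - (harmonic r : ℝ)) atTop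
      (𝓝 (-Real.log 4)) := by
  have h := tendsto_avgGapTime_one.add tendsto_integral_endGap
  rw [add_zero] at h
  refine h.congr fun r => ?_
  simp only [avgGapTime, average_gapTime isEndFactor_one, average_gapTime isEndFactor_erlang]
  have h1 : ∫ t in Set.Ioi (0 : ℝ),
      (innerGap r t - avgGap (gapFactor t) (fun l => erlang l t) r 0) =
      (∫ t in Set.Ioi (0 : ℝ), (1 - avgGap (gapFactor t) (fun l => erlang l t) r 0)) -
        ∫ t in Set.Ioi (0 : ℝ), (1 - avgGap (gapFactor t) (fun _ => 1) r 0) := by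
    rw [← integral_sub (integrableOn_avgGap isEndFactor_erlang r)
      (integrableOn_avgGap isEndFactor_one r)]
    refine setIntegral_congr_fun measurableSet_Ioi fun t _ => ?_
    simp only [innerGap]
    ring
  rw [h1]
  ring

/-! ### The lollipop -/

theorem getElem?_pathStep_succ {j : ℕ} {y : List (Fin 2)} {a b : Fin 2} (ha : y[j]? = some a)
    (hb : y[j + 1]? = some b) (i : ℕ) :
    (pathStep (j + 1) y)[i]? = if i = j ∨ i = j + 1 then some (a ⊓ b) else y[i]? := by
  induction j generalizing y i with
  | zero =>
    rcases y with _ | ⟨c, _ | ⟨d, z⟩⟩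
    · simp at ha
    · simp at hb
    · obtain rfl : c = a := by simpa using ha
      obtain rfl : d = b := by simpa using hb
      rcases i with _ | _ | i <;> simp [pathStep]
  | succ j ih =>
    rcases y with _ | ⟨c, z⟩
    · simp at ha
    · have := ih (y := z) (by simpa using ha) (by simpa using hb)
      rcases i with _ | i
      · simp [pathStep]
      · simp [pathStep, this]

theorem leadHigh_lt_length {y : List (Fin 2)} (hy : 0 ∈ y) : leadHigh y < y.length := by
  induction y with
  | nil => simp at hy
  | cons a y ih =>
    rw [leadHigh]
    split_ifs with ha
    · simp
    · have : 0 ∈ y := by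
        rcases List.mem_cons.1 hy with h | h
        · exact absurd h.symm ha
        · exact h
      simpa using ih this

theorem getElem?_leadHigh {y : List (Fin 2)} (hy : 0 ∈ y) : y[leadHigh y]? = some 0 := by
  induction y with
  | nil => simp at hy
  | cons a y ih =>
    rw [leadHigh]
    split_ifs with ha
    · simp [ha]
    · have : 0 ∈ y := by
        rcases List.mem_cons.1 hy with h | h
        · exact absurd h.symm ha
        · exact h
      simpa using ih this

theorem leadHigh_pathStep_le (y : List (Fin 2)) (j : ℕ) :
    leadHigh (pathStep j y) ≤ leadHigh y := by
  induction y generalizing j with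
  | nil => cases j <;> simp [pathStep]
  | cons a y ih =>
    rcases j with _ | _ | j
    · simp [pathStep, leadHigh]
    · rcases y with _ | ⟨b, z⟩
      · simp [pathStep]
      · rcases fin_two_cases a with rfl | rfl <;> rcases fin_two_cases b with rfl | rfl <;>
          simp [pathStep, leadHigh]
    · have := ih (j + 1)
      rw [pathStep, leadHigh, leadHigh]
      split_ifs
      · exact le_rfl
      · omega

theorem leadHigh_pathStep {y : List (Fin 2)} {j : ℕ} (hj : leadHigh y = j + 1)
    (hy : j + 1 < y.length) : leadHigh (pathStep (j + 1) y) = j := by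
  induction j generalizing y with
  | zero =>
    rcases y with _ | ⟨a, _ | ⟨b, z⟩⟩
    · simp at hy
    · simp at hy
    · rcases fin_two_cases a with rfl | rfl <;> rcases fin_two_cases b with rfl | rfl <;>
        simp_all [pathStep, leadHigh]
  | succ j ih =>
    rcases y with _ | ⟨a, z⟩
    · simp at hy
    · rw [leadHigh] at hj
      split_ifs at hj with ha
      rw [pathStep, leadHigh, if_neg ha, ih (by omega) (by simpa using hy)]

/-- With end factor `1` the potential vanishes at both consensuses, since an all-high path is a
single final run. -/
theorem gapTime_eq_zero {y : List (Fin 2)} (hy : (∀ a ∈ y, a = 0) ∨ ∀ a ∈ y, a = 1) :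
    gapTime (fun _ _ => 1) y = 0 := by
  have h0 : ∀ (t : ℝ) (y : List (Fin 2)), (∀ a ∈ y, a = 0) →
      gapProd (gapFactor t) (fun _ => 1) 0 y = 1 := by
    intro t y hy
    induction y with
    | nil => rfl
    | cons a y ih =>
      rw [gapProd, if_pos (hy a (by simp)), ih fun b hb => hy b (by simp [hb]), gapFactor,
        erlang_zero_left, one_mul]
  have h1 : ∀ (t : ℝ) (y : List (Fin 2)) (l : ℕ), (∀ a ∈ y, a = 1) →
      gapProd (gapFactor t) (fun _ => 1) l y = 1 := by
    intro t y l hy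
    induction y generalizing l with
    | nil => rfl
    | cons a y ih =>
      rw [gapProd, if_neg (by rw [hy a (by simp)]; exact one_ne_zero)]
      exact ih _ fun b hb => hy b (by simp [hb])
  rcases hy with hy | hy
  · simp [gapTime, h0 _ y hy]
  · simp [gapTime, h1 _ y 0 hy]

/-- The strategies along the path of the lollipop. -/
def pathList {m r : ℕ} (x : Fin m ⊕ Fin r → Fin 2) : List (Fin 2) :=
  List.ofFn fun i => x (.inr i)

theorem length_pathList {m r : ℕ} (x : Fin m ⊕ Fin r → Fin 2) : (pathList x).length = r :=
  List.length_ofFn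

theorem getElem?_pathList {m r : ℕ} (x : Fin m ⊕ Fin r → Fin 2) (i : ℕ) :
    (pathList x)[i]? = if h : i < r then some (x (.inr ⟨i, h⟩)) else none := by
  rw [pathList, List.getElem?_ofFn]

theorem mem_pathList {m r : ℕ} {x : Fin m ⊕ Fin r → Fin 2} {a : Fin 2} :
    a ∈ pathList x ↔ ∃ j, x (.inr j) = a := by
  simp [pathList, List.mem_ofFn]

section Lollipop

variable {n r : ℕ}

theorem lollipopAtt_zero (h : r < n) {j : Fin r} (hj : (j : ℕ) = 0) :
    lollipopAtt h j = .inl ⟨0, Nat.sub_pos_of_lt h⟩ := if_pos hj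

theorem lollipopAtt_succ (h : r < n) {i j : Fin r} (hij : (j : ℕ) = i + 1) :
    lollipopAtt h j = .inr i := by
  rw [lollipopAtt, if_neg (by omega)]
  congr 1
  exact Fin.ext (by simp [hij])

theorem pathList_pendant_succ (h : r < n) (x : Fin (n - r) ⊕ Fin r → Fin 2) {j : Fin r}
    (hj : (j : ℕ) ≠ 0) : pathList (stepLow ((isCliqueTree_lollipop h).pendant j) x) =
      pathStep j (pathList x) := by
  obtain ⟨j, hjr⟩ := j
  obtain ⟨k, rfl⟩ : ∃ k, j = k + 1 := Nat.exists_eq_succ_of_ne_zero hj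
  have hk : k < r := Nat.lt_of_succ_lt hjr
  have hatt : lollipopAtt h ⟨k + 1, hjr⟩ = .inr ⟨k, hk⟩ := lollipopAtt_succ h rfl
  refine List.ext_getElem? fun i => ?_
  rw [getElem?_pathStep_succ (a := x (.inr ⟨k, hk⟩)) (b := x (.inr ⟨k + 1, hjr⟩))
    (by rw [getElem?_pathList, dif_pos hk]) (by rw [getElem?_pathList, dif_pos hjr]),
    getElem?_pathList, getElem?_pathList]
  have hmem := (isCliqueTree_lollipop h).mem_edgeSet ⟨k + 1, hjr⟩
  have hstep : ∀ v, stepLow ((isCliqueTree_lollipop h).pendant ⟨k + 1, hjr⟩) x v =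
      if v = .inr ⟨k, hk⟩ ∨ v = .inr ⟨k + 1, hjr⟩ then
        x (.inr ⟨k, hk⟩) ⊓ x (.inr ⟨k + 1, hjr⟩) else x v := fun v => by
    have := stepLow_mk hmem x v
    simp only [hatt] at this
    refine Eq.trans ?_ this
    simp only [IsCliqueTree.pendant, hatt]
  by_cases hi : i < r
  · rw [dif_pos hi, dif_pos hi, hstep]
    simp only [Sum.inr.injEq, Fin.mk.injEq]
    split_ifs <;> rfl
  · rw [dif_neg hi, dif_neg hi, if_neg (by omega)]

theorem pathList_pendant_zero (h : r < n) (x : Fin (n - r) ⊕ Fin r → Fin 2) {j : Fin r}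
    (hj : (j : ℕ) = 0) : pathList (stepLow ((isCliqueTree_lollipop h).pendant j) x) =
      if x (lollipopAtt h j) = 0 then pathStep j (pathList x) else pathList x := by
  obtain ⟨j, hjr⟩ := j
  obtain rfl : j = 0 := hj
  have hne : ∀ i : Fin r, (Sum.inr i : Fin (n - r) ⊕ Fin r) ≠ lollipopAtt h ⟨0, hjr⟩ := by
    simp [lollipopAtt]
  obtain ⟨s, rfl⟩ := Nat.exists_eq_succ_of_ne_zero (Nat.ne_of_gt hjr)
  have h0 : stepLow ((isCliqueTree_lollipop h).pendant ⟨0, hjr⟩) x (.inr 0) =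
      x (lollipopAtt h ⟨0, hjr⟩) ⊓ x (.inr 0) := stepLow_right _ x
  have hsucc : ∀ i : Fin s, stepLow ((isCliqueTree_lollipop h).pendant ⟨0, hjr⟩) x (.inr i.succ) =
      x (.inr i.succ) := fun i => stepLow_of_ne _ x (hne _) (by simp [Fin.ext_iff])
  simp only [pathList, List.ofFn_succ, h0, hsucc]
  rcases fin_two_cases (x (lollipopAtt h ⟨0, hjr⟩)) with ha | ha
  · rw [ha, if_pos rfl]
    simp [pathStep]
  · have : (1 : Fin 2) ⊓ x (.inr 0) = x (.inr 0) := by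
      rcases fin_two_cases (x (.inr (0 : Fin (s + 1)))) with hb | hb <;> simp [hb]
    rw [ha, this, if_neg one_ne_zero]

theorem pathList_clique (h : r < n) (e : (⊤ : SimpleGraph (Fin (n - r))).edgeSet)
    (x : Fin (n - r) ⊕ Fin r → Fin 2) :
    pathList (stepLow (⟨e.1.map Sum.inl, (isCliqueTree_lollipop h).map_inl_mem e.2⟩ :
      (lollipop n r).edgeSet) x) = pathList x := by
  simp only [pathList, (isCliqueTree_lollipop h).stepLow_clique_inr e x]

theorem pathList_stepLow (h : r < n) (e : (lollipop n r).edgeSet)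
    (x : Fin (n - r) ⊕ Fin r → Fin 2) : pathList (stepLow e x) = pathList x ∨
      ∃ j < (pathList x).length, pathList (stepLow e x) = pathStep j (pathList x) := by
  obtain ⟨d | j, rfl⟩ := (isCliqueTree_lollipop h).bijective_edgeMap.2 e
  · exact Or.inl (pathList_clique h d x)
  · by_cases hj : (j : ℕ) = 0
    · have := pathList_pendant_zero h x hj
      split_ifs at this
      · exact Or.inr ⟨j, by rw [length_pathList]; exact j.2, this⟩
      · exact Or.inl this
    · exact Or.inr ⟨j, by rw [length_pathList]; exact j.2, pathList_pendant_succ h x hj⟩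

theorem sum_gapTime_pathList {E : ℝ → ℕ → ℝ} (hE : IsEndFactor E)
    (x : Fin (n - r) ⊕ Fin r → Fin 2) :
    ∑ j : Fin r, (gapTime E (pathList x) - gapTime E (pathStep j (pathList x))) =
      1 - gapProd (gapFactor 0) (E 0) 0 (pathList x) := by
  rw [← sum_gapTime_sub hE, length_pathList,
    Finset.sum_range fun j => gapTime E (pathList x) - gapTime E (pathStep j (pathList x))]

theorem lollipop_sum_sub (h : r < n) [Fintype (lollipop n r).edgeSet] (E : ℝ → ℕ → ℝ)
    (x : Fin (n - r) ⊕ Fin r → Fin 2) :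
    ∑ e : (lollipop n r).edgeSet, (gapTime E (pathList x) - gapTime E (pathList (stepLow e x))) =
      ∑ j, (gapTime E (pathList x) -
        gapTime E (pathList (stepLow ((isCliqueTree_lollipop h).pendant j) x))) := by
  rw [(isCliqueTree_lollipop h).sum_edgeSet, Finset.sum_eq_zero, zero_add]
  intro e _
  rw [pathList_clique h, sub_self]

/-- Next to an all-low clique every path edge acts as `pathStep`, and the Erlang end factor makes
the Poisson sum equal to one. While the clique is all high, `leadHigh` counts the path vertices that
the nearest low one must still cross; its mean is at most one. -/
theorem expectedTimeZero_lollipop_le (h : r < n) :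
    expectedTimeZero (lollipop n r) ≤ ENNReal.ofReal (numEdges (lollipop n r) *
      (avgGapTime (fun t l => erlang l t) r + (fillTime (n - r) 1 + (2 ^ (n - r))⁻¹ * 2))) := by
  classical
  have hG := isCliqueTree_lollipop h
  have hE := isEndFactor_erlang
  refine (expectedTimeZero_le_clique (G := lollipop n r)
    (B := fun x => gapTime (fun t l => erlang l t) (pathList x))
    (d := fun x => (leadHigh (pathList x) : ℝ))
    (fun a b => (hG.adj_inl a b).2) (fun x => gapTime_nonneg hE _)
    (fun e x => ?_) (fun _ => Nat.cast_nonneg _) (fun e x => ?_) ?_ ?_).trans ?_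
  · rcases pathList_stepLow h e x with he | ⟨j, hj, he⟩
    · rw [he]
    · rw [he]
      exact gapTime_pathStep_le hE _ hj
  · rcases pathList_stepLow h e x with he | ⟨j, hj, he⟩
    · rw [he]
    · rw [he]
      exact_mod_cast leadHigh_pathStep_le _ _
  · intro x hx h0
    have hstep : ∀ j, pathList (stepLow (hG.pendant j) x) = pathStep j (pathList x) := by
      intro j
      by_cases hj : (j : ℕ) = 0
      · rw [pathList_pendant_zero h x hj, lollipopAtt_zero h hj, if_pos (h0 _)]
      · exact pathList_pendant_succ h x hj
    rw [lollipop_sum_sub h]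
    simp only [hstep]
    rw [sum_gapTime_pathList hE, gapProd_zero_eq_zero (E := fun t l => erlang l t)
      (fun l hl => erlang_zero_right hl),
      sub_zero]
    refine Or.inr (mem_pathList.2 ?_)
    by_contra! hall
    refine hx ?_
    have : ∀ v, x v = 0 := by
      rintro (a | j)
      · exact h0 a
      · exact (fin_two_cases _).resolve_right (hall j)
    intro u v
    rw [this, this]
  · intro x hx h1
    have hmem : (0 : Fin 2) ∈ pathList x := by
      rw [mem_pathList]
      by_contra! hall
      refine hx ?_
      have : ∀ v, x v = 1 := by
        rintro (a | j)
        · exact h1 a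
        · exact eq_one_of_ne_zero (hall j)
      intro u v
      rw [this, this]
    have hlt := leadHigh_lt_length hmem
    have hget := getElem?_leadHigh hmem
    have hlt' := hlt
    rw [length_pathList] at hlt'
    rw [getElem?_pathList, dif_pos hlt'] at hget
    have hget : x (.inr ⟨leadHigh (pathList x), hlt'⟩) = 0 := Option.some.inj hget
    -- The edge into the first low path vertex from the side of the clique.
    refine ⟨hG.pendant ⟨leadHigh (pathList x), hlt'⟩, ?_⟩
    by_cases hk : leadHigh (pathList x) = 0
    · refine Or.inl ⟨⟨0, Nat.sub_pos_of_lt h⟩, ?_⟩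
      have := stepLow_left (hG.mem_edgeSet ⟨leadHigh (pathList x), hlt'⟩) x
      rw [hget] at this
      rw [← lollipopAtt_zero h (j := ⟨leadHigh (pathList x), hlt'⟩) hk]
      exact this.trans (by simp)
    · refine Or.inr ?_
      obtain ⟨k, hk'⟩ := Nat.exists_eq_succ_of_ne_zero hk
      rw [pathList_pendant_succ h x hk]
      have h2 : leadHigh (pathStep (leadHigh (pathList x)) (pathList x)) + 1 =
          leadHigh (pathList x) := by
        have := leadHigh_pathStep hk' (by omega)
        rw [hk', this]
      exact_mod_cast h2.le
  · refine ENNReal.ofReal_le_ofReal (mul_le_mul_of_nonneg_left ?_ (Nat.cast_nonneg _))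
    rw [average_add]
    have h1 := average_inr (m := n - r)
      (fun y : Fin r → Fin 2 => gapTime (fun t l => erlang l t) (List.ofFn y))
    have h2 := average_cliquePart_le (m := n - r) (r := r)
      (d := fun y => (leadHigh (List.ofFn y) : ℝ)) fun _ => Nat.cast_nonneg _
    have h3 := average_leadHigh_le r
    have h4 : (2 ^ (n - r) : ℝ)⁻¹ *
        (1 + average fun y : Fin r → Fin 2 => (leadHigh (List.ofFn y) : ℝ)) ≤
        (2 ^ (n - r))⁻¹ * 2 := by
      refine mul_le_mul_of_nonneg_left ?_ (by positivity)
      linarith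
    simp only [pathList, avgGapTime]
    linarith

/-- If the clique vertex at the path is high, the first path edge leaves the path unchanged, and the
Poisson sum only loses a nonnegative term. So it is at most one for every state of the clique. -/
theorem le_expectedTimeZero_lollipop (h : r < n) :
    ENNReal.ofReal (numEdges (lollipop n r) * avgGapTime (fun _ _ => 1) r) ≤
      expectedTimeZero (lollipop n r) := by
  classical
  have hG := isCliqueTree_lollipop h
  have hE := isEndFactor_one
  have hav : average (fun x : Fin (n - r) ⊕ Fin r → Fin 2 =>
      gapTime (fun _ _ => 1) (pathList x)) = avgGapTime (fun _ _ => 1) r :=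
    average_inr (m := n - r) (fun y : Fin r → Fin 2 => gapTime (fun _ _ => 1) (List.ofFn y))
  rw [← hav]
  refine le_expectedTimeZero (lollipop n r) (fun x => gapTime_nonneg hE _) (fun x hx => ?_)
    (fun x _ => ?_)
    (ne_top_of_le_ne_top ENNReal.ofReal_ne_top (expectedTimeZero_lollipop_le h))
  · refine gapTime_eq_zero ?_
    rcases fin_two_cases (x (.inl ⟨0, Nat.sub_pos_of_lt h⟩)) with h0 | h1
    · left
      intro a ha
      obtain ⟨j, rfl⟩ := mem_pathList.1 ha
      rw [hx (.inr j) (.inl ⟨0, Nat.sub_pos_of_lt h⟩), h0]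
    · right
      intro a ha
      obtain ⟨j, rfl⟩ := mem_pathList.1 ha
      rw [hx (.inr j) (.inl ⟨0, Nat.sub_pos_of_lt h⟩), h1]
  · rw [lollipop_sum_sub h]
    have h1 := sum_gapTime_pathList hE x
    have h2 : 0 ≤ gapProd (gapFactor 0) (fun _ => 1) 0 (pathList x) :=
      gapProd_nonneg (gapFactor_nonneg le_rfl) (fun _ => zero_le_one) _ _
    refine (Finset.sum_le_sum fun j _ => ?_).trans (h1.trans_le (by linarith))
    by_cases hj : (j : ℕ) = 0
    · rw [pathList_pendant_zero h x hj]
      split_ifs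
      · exact le_rfl
      · rw [sub_self]
        exact sub_nonneg.2 (gapTime_pathStep_le hE _ (by rw [length_pathList]; exact j.2))
    · rw [pathList_pendant_succ h x hj]

end Lollipop

/-! ### Asymptotics of the expected times -/

theorem tendsto_snd_bothLarge : Tendsto (fun q : ℕ × ℕ => q.2) bothLarge atTop :=
  tendsto_comap.mono_left inf_le_left

theorem tendsto_sub_bothLarge : Tendsto (fun q : ℕ × ℕ => q.1 - q.2) bothLarge atTop :=
  tendsto_comap.mono_left inf_le_right

theorem tendsto_clique_error :
    Tendsto (fun m : ℕ => fillTime m 1 + ((2 : ℝ) ^ m)⁻¹ * 2) atTop (𝓝 0) := by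
  have h := (tendsto_inv_atTop_zero.comp
    (tendsto_pow_atTop_atTop_of_one_lt (one_lt_two : (1 : ℝ) < 2))).mul_const 2
  have := tendsto_fillTime_one.add h
  simpa [Function.comp_def] using this

theorem tendsto_sundew_error :
    Tendsto (fun r : ℕ => ((2 : ℝ) ^ r)⁻¹ * (harmonic r : ℝ)) atTop (𝓝 0) := by
  have h := tendsto_pow_const_mul_const_pow_of_abs_lt_one 1 (r := (1 / 2 : ℝ))
    (by norm_num [abs_of_pos])
  refine tendsto_of_tendsto_of_tendsto_of_le_of_le tendsto_const_nhds h
    (fun r => mul_nonneg (by positivity) (harmonic_nonneg r)) fun r => ?_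
  have h1 : (harmonic r : ℝ) ≤ r := by
    induction r with
    | zero => simp
    | succ r ih =>
      rw [harmonic_succ]
      push_cast
      have : ((r : ℝ) + 1)⁻¹ ≤ 1 := inv_le_one_of_one_le₀ (by linarith [Nat.cast_nonneg (α := ℝ) r])
      linarith
  simp only [pow_one, one_div, inv_pow]
  rw [mul_comm]
  gcongr

/-- The error is the normalized time minus its main term, squeezed between the two bounds. -/
theorem exists_error_term {f : ℕ → ℕ → ℝ≥0∞} {e : ℕ → ℕ → ℕ} {lo up : ℕ → ℝ} {c : ℝ}
    (hup : ∀ n r, r < n → f n r ≤ ENNReal.ofReal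
      (e n r * (up r + (fillTime (n - r) 1 + (2 ^ (n - r))⁻¹ * 2))))
    (hup0 : ∀ r, 0 ≤ up r) (hlo : ∀ n r, r < n → ENNReal.ofReal (e n r * lo r) ≤ f n r)
    (hupt : Tendsto (fun r => up r - (harmonic r : ℝ)) atTop (𝓝 (-c)))
    (hlot : Tendsto (fun r => lo r - (harmonic r : ℝ)) atTop (𝓝 (-c)))
    (he : ∀ n r, r < n → 0 < r → 0 < e n r) :
    ∃ δ : ℕ → ℕ → ℝ, Tendsto (fun q : ℕ × ℕ => δ q.1 q.2) bothLarge (𝓝 0) ∧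
      ∀ n r : ℕ, r < n → (f n r).toReal = (e n r : ℝ) * ((harmonic r : ℝ) - c + δ n r) := by
  refine ⟨fun n r => (f n r).toReal / e n r - ((harmonic r : ℝ) - c), ?_, fun n r h => ?_⟩
  · have h1 := (hlot.add_const c).comp tendsto_snd_bothLarge
    have h2 := ((hupt.add_const c).comp tendsto_snd_bothLarge).add
      (tendsto_clique_error.comp tendsto_sub_bothLarge)
    rw [neg_add_cancel] at h1 h2
    rw [add_zero] at h2
    refine tendsto_of_tendsto_of_tendsto_of_le_of_le' h1 h2 ?_ ?_
    · filter_upwards [tendsto_snd_bothLarge.eventually_gt_atTop 0,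
        tendsto_sub_bothLarge.eventually_gt_atTop 0] with q hr hn
      have hq : q.2 < q.1 := by omega
      have he' : (0 : ℝ) < e q.1 q.2 := by exact_mod_cast he _ _ hq hr
      have hfin : f q.1 q.2 ≠ ⊤ := ne_top_of_le_ne_top ENNReal.ofReal_ne_top (hup _ _ hq)
      have h3 : e q.1 q.2 * lo q.2 ≤ (f q.1 q.2).toReal :=
        (ENNReal.ofReal_le_iff_le_toReal hfin).1 (hlo _ _ hq)
      have h4 : lo q.2 ≤ (f q.1 q.2).toReal / e q.1 q.2 := by
        rw [le_div_iff₀ he']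
        linarith
      simp only [Function.comp_apply]
      linarith
    · filter_upwards [tendsto_snd_bothLarge.eventually_gt_atTop 0,
        tendsto_sub_bothLarge.eventually_gt_atTop 0] with q hr hn
      have hq : q.2 < q.1 := by omega
      have he' : (0 : ℝ) < e q.1 q.2 := by exact_mod_cast he _ _ hq hr
      have h5 := hup0 q.2
      have h6 := fillTime_nonneg (q.1 - q.2) 1
      have h3 := ENNReal.toReal_le_of_le_ofReal (by positivity) (hup _ _ hq)
      have h4 : (f q.1 q.2).toReal / e q.1 q.2 ≤
          up q.2 + (fillTime (q.1 - q.2) 1 + (2 ^ (q.1 - q.2))⁻¹ * 2) := by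
        rw [div_le_iff₀ he']
        linarith
      simp only [Function.comp_apply]
      linarith
  -- Without edges the upper bound forces the time to be zero, so the identity survives the division
  -- by zero.
  · by_cases he0 : e n r = 0
    · have h1 := hup n r h
      rw [he0, Nat.cast_zero, zero_mul, ENNReal.ofReal_zero, nonpos_iff_eq_zero] at h1
      rw [h1, he0]
      simp
    · have : (e n r : ℝ) ≠ 0 := by exact_mod_cast he0
      field_simp
      ring

theorem exists_forall_of_eventually_bothLarge {P : ℕ × ℕ → Prop} (h : ∀ᶠ q in bothLarge, P q) :
    ∃ N : ℕ, ∀ n r : ℕ, N ≤ r → N ≤ n - r → P (n, r) := by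
  obtain ⟨s, hs, t, ht, hst⟩ := Filter.mem_inf_iff_superset.1 h
  obtain ⟨a, ha⟩ := (atTop_basis.comap fun q : ℕ × ℕ => q.2).mem_iff.1 hs
  obtain ⟨b, hb⟩ := (atTop_basis.comap fun q : ℕ × ℕ => q.1 - q.2).mem_iff.1 ht
  exact ⟨max a b, fun n r hr hn => @hst (n, r)
    ⟨ha.2 ((le_max_left a b).trans hr), hb.2 ((le_max_right a b).trans hn)⟩⟩

theorem numEdges_lollipop_pos {n r : ℕ} (h : r < n) (hr : 0 < r) : 0 < numEdges (lollipop n r) := by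
  rw [(isCliqueTree_lollipop h).numEdges_eq, Nat.card_eq_fintype_card, Fintype.card_sum,
    Fintype.card_fin]
  omega

theorem binomialHarmonic_nonneg (r : ℕ) : 0 ≤ binomialHarmonic r := by
  refine Finset.sum_nonneg fun j _ => div_nonneg (sub_nonneg.2 (inv_le_one_of_one_le₀ ?_))
    (by positivity)
  exact one_le_pow₀ one_le_two

theorem avgGapTime_nonneg {E : ℝ → ℕ → ℝ} (hE : IsEndFactor E) (r : ℕ) : 0 ≤ avgGapTime E r :=
  mul_nonneg (by positivity) (Finset.sum_nonneg fun _ _ => gapTime_nonneg hE _)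

end Consensus

end

/-! ### Finiteness, asymptotics and comparison of the two families. -/

theorem mainTheorem5 :
    -- the sundew
    ((∀ n r : ℕ, r < n → Consensus.expectedTimeZero (Consensus.sundew n r) ≠ ⊤) ∧
      ∃ δ : ℕ → ℕ → ℝ,
        Tendsto (fun q : ℕ × ℕ => δ q.1 q.2) Consensus.bothLarge (𝓝 0) ∧
        ∀ n r : ℕ, r < n →
          (Consensus.expectedTimeZero (Consensus.sundew n r)).toReal =
            (Consensus.numEdges (Consensus.sundew n r) : ℝ) *
              ((harmonic r : ℝ) - Real.log 2 + δ n r)) ∧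
    -- the lollipop
    ((∀ n r : ℕ, r < n → Consensus.expectedTimeZero (Consensus.lollipop n r) ≠ ⊤) ∧
      ∃ δ : ℕ → ℕ → ℝ,
        Tendsto (fun q : ℕ × ℕ => δ q.1 q.2) Consensus.bothLarge (𝓝 0) ∧
        ∀ n r : ℕ, r < n →
          (Consensus.expectedTimeZero (Consensus.lollipop n r)).toReal =
            (Consensus.numEdges (Consensus.lollipop n r) : ℝ) *
              ((harmonic r : ℝ) - Real.log 4 + δ n r)) ∧
    -- the comparison
    (∀ n r : ℕ, r < n →
      Consensus.numEdges (Consensus.sundew n r) = Consensus.numEdges (Consensus.lollipop n r)) ∧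
    ∃ N : ℕ, ∀ n r : ℕ, r ≤ n → N ≤ r → N ≤ n - r →
      Consensus.expectedTimeZero (Consensus.lollipop n r) <
        Consensus.expectedTimeZero (Consensus.sundew n r) := by
  have hS : ∀ n r : ℕ, r < n → Consensus.expectedTimeZero (Consensus.sundew n r) ≠ ⊤ := fun n r h =>
    ne_top_of_le_ne_top ENNReal.ofReal_ne_top (Consensus.expectedTimeZero_sundew_le h)
  have hL : ∀ n r : ℕ, r < n → Consensus.expectedTimeZero (Consensus.lollipop n r) ≠ ⊤ := fun n r h =>
    ne_top_of_le_ne_top ENNReal.ofReal_ne_top (Consensus.expectedTimeZero_lollipop_le h)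
  obtain ⟨δ, hδ, hδe⟩ := Consensus.exists_error_term (f := fun n r => Consensus.expectedTimeZero (Consensus.sundew n r))
    (e := fun n r => Consensus.numEdges (Consensus.sundew n r)) (up := Consensus.binomialHarmonic)
    (lo := fun r => Consensus.binomialHarmonic r - (2 ^ r)⁻¹ * harmonic r) (c := Real.log 2)
    (fun n r h => Consensus.expectedTimeZero_sundew_le h) Consensus.binomialHarmonic_nonneg
    (fun n r h => Consensus.le_expectedTimeZero_sundew h) Consensus.tendsto_binomialHarmonic_sub
    (by
      have h := Consensus.tendsto_binomialHarmonic_sub.sub Consensus.tendsto_sundew_error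
      rw [sub_zero] at h
      exact h.congr fun r => by ring)
    (fun n r h hr => Consensus.numEdges_sundew_eq h ▸ Consensus.numEdges_lollipop_pos h hr)
  obtain ⟨ε, hε, hεe⟩ := Consensus.exists_error_term (f := fun n r => Consensus.expectedTimeZero (Consensus.lollipop n r))
    (e := fun n r => Consensus.numEdges (Consensus.lollipop n r)) (up := Consensus.avgGapTime fun t l => Consensus.erlang l t)
    (lo := Consensus.avgGapTime fun _ _ => 1) (c := Real.log 4)
    (fun n r h => Consensus.expectedTimeZero_lollipop_le h) (Consensus.avgGapTime_nonneg Consensus.isEndFactor_erlang)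
    (fun n r h => Consensus.le_expectedTimeZero_lollipop h) Consensus.tendsto_avgGapTime_erlang
    Consensus.tendsto_avgGapTime_one (fun n r h hr => Consensus.numEdges_lollipop_pos h hr)
  refine ⟨⟨hS, δ, hδ, hδe⟩, ⟨hL, ε, hε, hεe⟩, fun n r h => Consensus.numEdges_sundew_eq h, ?_⟩
  have hlog : Real.log 2 < Real.log 4 := Real.log_lt_log (by norm_num) (by norm_num)
  have hev : ∀ᶠ q in Consensus.bothLarge, 0 < Real.log 4 - Real.log 2 + (δ q.1 q.2 - ε q.1 q.2) := by
    have h := (hδ.sub hε).const_add (Real.log 4 - Real.log 2)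
    rw [sub_zero, add_zero] at h
    exact h.eventually_const_lt (by linarith)
  obtain ⟨N, hN⟩ := Consensus.exists_forall_of_eventually_bothLarge hev
  -- The `1` ensures `r < n` and a positive number of edges.
  refine ⟨max N 1, fun n r _ hr hn => ?_⟩
  have hr1 : 1 ≤ r := (le_max_right N 1).trans hr
  have hn1 : 1 ≤ n - r := (le_max_right N 1).trans hn
  have h : r < n := by omega
  rw [← ENNReal.toReal_lt_toReal (hL n r h) (hS n r h), hδe n r h, hεe n r h]
  have h1 := hN n r ((le_max_left N 1).trans hr) ((le_max_left N 1).trans hn)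
  have h2 : (0 : ℝ) < Consensus.numEdges (Consensus.lollipop n r) := by exact_mod_cast Consensus.numEdges_lollipop_pos h hr1
  simp only [Consensus.numEdges_sundew_eq h]
  refine mul_lt_mul_of_pos_left ?_ h2
  simp only at h1
  linarith
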